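/- Let $\mathbf{K}$ be a field, let $m,n\ge 3$ be integers, and let $P=[m]$ be the chain $1<2<\cdots<m$. Let $R=\mathbf{K}[X_{p,i}\mid p\in P,\ i\in[n]]$ and let $$\mathcal{L}(P,n)=\Bigl(\prod_{p\in P}X_{p,f(p)}\ \Big|\ f:P\to[n]\text{ isotone (that is, } p\le q\text{ implies } f(p)\le f(q))\Bigr)\subseteq R .$$ For a monomial ideal $I\subseteq R$ with minimal multigraded free resolution $\cdots\to F_1\to F_0\to I\to 0$, where $F_i=\bigoplus_j R(-\mathbf{a}_{i,j})$, the $i$th homological shift ideal of $I$ is $\mathrm{HS}_i(I)=(X^{\mathbf{a}_{i,j}}\mid j)$. Then $\mathrm{HS}_2(\mathcal{L}(P,n))$ does not have a linear resolution; that is, there is no integer $e$ for which the $i$th module of its minimal graded free resolution, with respect to the standard grading of $R$, is a direct sum of copies of $R(-e-i)$ for every $i\ge 0$. -/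

import Mathlib

universe u v w

/-- A graded free resolution `⋯ → F₂ → F₁ → F₀ → I → 0`, by free modules of finite rank, of an
ideal `I` of the polynomial ring `R = K[X_x : x ∈ σ]`, which is graded by an abelian group `M`
through `deg X_x = wt x`.

The module `F_i = ⨁_j R(-shift i j)` is `ι i →₀ R`, whose basis vector `e_j` has degree
`shift i j`. Homogeneity of the maps (of degree zero) says that the `(k, j)` entry of
`d i : F_{i+1} → F_i` is homogeneous of degree `shift (i+1) j - shift i k`. -/
structure GradedFreeResolution {σ : Type v} {K : Type u} [Field K] {M : Type w} [AddCommGroup M]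
    (wt : σ → M) (I : Ideal (MvPolynomial σ K)) where
  /-- the index set of the basis of `F_i` -/
  ι : ℕ → Type
  finite : ∀ i, Finite (ι i)
  /-- the degrees of the basis vectors -/
  shift : ∀ i, ι i → M
  /-- the differential `F_{i+1} → F_i` -/
  d : ∀ i, (ι (i + 1) →₀ MvPolynomial σ K) →ₗ[MvPolynomial σ K] (ι i →₀ MvPolynomial σ K)
  /-- the augmentation `F₀ → I ⊆ R` -/
  ε : (ι 0 →₀ MvPolynomial σ K) →ₗ[MvPolynomial σ K] MvPolynomial σ K
  homogeneous_d : ∀ (i : ℕ) (j : ι (i + 1)) (k : ι i),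
    MvPolynomial.IsWeightedHomogeneous wt (d i (Finsupp.single j 1) k)
      (shift (i + 1) j - shift i k)
  homogeneous_ε : ∀ j : ι 0,
    MvPolynomial.IsWeightedHomogeneous wt (ε (Finsupp.single j 1)) (shift 0 j)
  range_ε : LinearMap.range ε = I
  exact_ε : Function.Exact (d 0) ε
  exact_d : ∀ i, Function.Exact (d (i + 1)) (d i)

/-- The resolution is minimal: `d(F_{i+1}) ⊆ 𝔪 F_i` for all `i ≥ 0`, where `𝔪` is the ideal
generated by the variables, that is, the entries of the differentials have no constant term. -/
def GradedFreeResolution.IsMinimal {σ : Type v} {K : Type u} [Field K] {M : Type w}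
    [AddCommGroup M] {wt : σ → M} {I : Ideal (MvPolynomial σ K)}
    (F : GradedFreeResolution wt I) : Prop :=
  ∀ (i : ℕ) (j : F.ι (i + 1)) (k : F.ι i),
    MvPolynomial.constantCoeff (F.d i (Finsupp.single j 1) k) = 0

/-- The weights of the standard grading by `ℤ`: every variable has degree `1`. -/
def standardWeight (σ : Type v) : σ → ℤ := fun _ => 1

open Classical in
/-- The weights of the multigrading by `ℤ^σ`: the variable `X_x` has the unit vector at `x` as
its degree. -/
noncomputable def multiWeight (σ : Type v) : σ → (σ → ℤ) := fun x => Pi.single x 1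

/-- An ideal has a linear resolution if, for some `e`, it has a (`ℤ`-)graded minimal free
resolution with `F_i = ⨁ R(-(e + i))` for all `i`. -/
def HasLinearResolution {σ : Type v} {K : Type u} [Field K] (I : Ideal (MvPolynomial σ K)) :
    Prop :=
  ∃ F : GradedFreeResolution (standardWeight σ) I, F.IsMinimal ∧
    ∃ e : ℤ, ∀ (i : ℕ) (j : F.ι i), F.shift i j = e + i

/-- `a` is an `i`th multigraded shift of `I`: it is the multidegree of a basis vector of `F_i`, for
a minimal multigraded free resolution `F` of `I` (which is unique up to isomorphism). -/
def IsMultigradedShift {σ : Type v} {K : Type u} [Field K] (I : Ideal (MvPolynomial σ K)) (i : ℕ)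
    (a : σ → ℤ) : Prop :=
  ∃ F : GradedFreeResolution (multiWeight σ) I, F.IsMinimal ∧ ∃ j : F.ι i, F.shift i j = a

/-- The `i`th homological shift ideal `HS_i(I)`, generated by the monomials `X^a` for the `i`th
multigraded shifts `a` of `I` (which have non-negative entries). -/
noncomputable def homologicalShiftIdeal {σ : Type v} {K : Type u} [Field K] (i : ℕ)
    (I : Ideal (MvPolynomial σ K)) : Ideal (MvPolynomial σ K) :=
  Ideal.span {u | ∃ a : σ →₀ ℕ, IsMultigradedShift I i (fun x => (a x : ℤ)) ∧
    u = MvPolynomial.monomial a 1}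

/-- The co-letterplace ideal `L(P, n)` of a finite poset `P` in `K[X_{p,i} : p ∈ P, i ∈ [n]]`,
generated by the monomials `∏_p X_{p, f(p)}` for the isotone maps `f : P → [n]`. -/
noncomputable def coLetterplaceIdeal (K : Type u) [Field K] (P : Type v) [PartialOrder P]
    [Fintype P] (n : ℕ) : Ideal (MvPolynomial (P × Fin n) K) :=
  Ideal.span (Set.range fun f : P →o Fin n => ∏ p : P, MvPolynomial.X (p, f p))

open MvPolynomial

/-! Order `[m] × [n]` componentwise and call a chain that meets every row a cell. Cells with `m`
points are the graphs of isotone maps, that is, the generators of the co-letterplace ideal. Cells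
with `m + i` points index the `i`th module of a complex whose differential deletes a point, with a
sign, and multiplies by its variable (`cellResolution`). In a fixed multidegree `b` this is the
simplicial chain complex of the chains in the support of `b`, relative to those missing some row.
Coning row by row over the lowest column in use deforms a relative cycle onto a single graph, so
every strand is exact (`exists_boundary_eq_of_cycle`). The entries of the differential are zero or
variables up to sign, so the resolution is minimal; comparison with other minimal resolutions
(`exists_shift_two_eq`) shows that `HS_2` is generated by the squarefree monomials of the cells with
`m + 2` points.

Among these, `lowerCell` and `upperCell` give an isolated pair `X^u`, `X^v`: because there is a row
strictly between the first and the last, no third generator divides their lcm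
(`eq_lowerCell_or_eq_upperCell`). In a linear resolution the syzygy of this pair would be a
combination of linear syzygies. Below the lcm such a syzygy can involve only `X^u` and `X^v`, and it
cannot join them, since `X^v` divides no `X_x X^u` (`not_hasLinearResolution_of_isolated_pair`). -/

theorem LinearMap.apply_eq_sum_single {ι R N : Type*} [Fintype ι] [CommSemiring R]
    [AddCommMonoid N] [Module R N] (f : (ι →₀ R) →ₗ[R] N) (z : ι →₀ R) :
    f z = ∑ k, z k • f (Finsupp.single k 1) := by
  conv_lhs => rw [← Finsupp.univ_sum_single z]
  rw [map_sum]
  refine Finset.sum_congr rfl fun k _ => ?_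
  rw [← map_smul, Finsupp.smul_single, smul_eq_mul, mul_one]

/-! ### Linear resolutions and isolated pairs of generators -/

theorem weight_standardWeight {σ : Type*} (d : σ →₀ ℕ) :
    Finsupp.weight (standardWeight σ) d = (d.degree : ℤ) := by
  simp [Finsupp.weight_apply, standardWeight, Finsupp.degree_apply, Finsupp.sum]

theorem Finsupp.eq_of_le_of_degree_eq {σ : Type*} {a b : σ →₀ ℕ} (h : a ≤ b)
    (hd : a.degree = b.degree) : a = b := by
  obtain ⟨c, rfl⟩ := le_iff_exists_add.mp h
  have : c.degree = 0 := by
    have := map_add (Finsupp.degree (R := ℕ)) a c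
    omega
  rw [Finsupp.degree_eq_zero_iff] at this
  simp [this]

theorem Finsupp.exists_eq_single_of_degree_eq_one {σ : Type*} {a : σ →₀ ℕ}
    (hd : a.degree = 1) : ∃ x, a = Finsupp.single x 1 := by
  have h0 : a ≠ 0 := by
    rintro rfl
    simp at hd
  obtain ⟨x, hx⟩ := Finsupp.support_nonempty_iff.mpr h0
  refine ⟨x, (Finsupp.eq_of_le_of_degree_eq ?_ ?_).symm⟩
  · rw [Finsupp.single_le_iff]
    have := Finsupp.mem_support_iff.mp hx
    omega
  · simp [hd]

/-- A monomial ideal generated in a single degree has no linear resolution if it has two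
generators `X^u`, `X^v` which are the only ones that divide their least common multiple, and
`X^v` divides no product of `X^u` with a variable. -/
theorem not_hasLinearResolution_of_isolated_pair {σ K : Type*} [Field K] {S : Set (σ →₀ ℕ)}
    {N : ℕ} (hS : ∀ a ∈ S, a.degree = N) {u v : σ →₀ ℕ} (hu : u ∈ S) (hv : v ∈ S) (huv : u ≠ v)
    (hpair : ∀ a ∈ S, a ≤ u ⊔ v → a = u ∨ a = v)
    (hfar : ∀ x, ¬ v ≤ u + Finsupp.single x 1) :
    ¬ HasLinearResolution
      (Ideal.span ((fun a => monomial a (1 : K)) '' S) : Ideal (MvPolynomial σ K)) := by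
  rintro ⟨F, -, e, he⟩
  classical
  have := F.finite 0
  have := F.finite 1
  have := Fintype.ofFinite (F.ι 0)
  have := Fintype.ofFinite (F.ι 1)
  have hmem : ∀ z, F.ε z ∈ Ideal.span ((fun a => monomial a (1 : K)) '' S) := fun z => by
    have h : F.ε z ∈ LinearMap.range F.ε := LinearMap.mem_range_self _ z
    rwa [F.range_ε] at h
  have hsupp : ∀ z c, coeff c (F.ε z) ≠ 0 → ∃ a ∈ S, a ≤ c := fun z c hc => by
    have h := hmem z
    rw [mem_ideal_span_monomial_image] at h
    exact h c (mem_support_iff.mpr hc)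
  have hsurj : ∀ a ∈ S, ∃ z, F.ε z = monomial a 1 := fun a ha => by
    have h : monomial a (1 : K) ∈ LinearMap.range F.ε := by
      rw [F.range_ε]
      exact Ideal.subset_span ⟨a, ha, rfl⟩
    exact h
  have hdegε : ∀ k c, coeff c (F.ε (Finsupp.single k 1)) ≠ 0 → (c.degree : ℤ) = e :=
    fun k c hc => by
      have h := F.homogeneous_ε k hc
      rw [weight_standardWeight, he] at h
      simpa using h
  obtain ⟨g, hg⟩ := hsurj u hu
  obtain ⟨h, hh⟩ := hsurj v hv
  -- Some basis vector of `F_0` contributes to the coefficient of `X^u`; its degree `e` is squeezed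
  -- between the degree of a generator and that of `u`.
  have heN : e = N := by
    have h1 : coeff u (F.ε g) ≠ 0 := by
      rw [hg, coeff_monomial, if_pos rfl]
      exact one_ne_zero
    rw [F.ε.apply_eq_sum_single, coeff_sum] at h1
    obtain ⟨k, -, hk⟩ := Finset.exists_ne_zero_of_sum_ne_zero h1
    rw [smul_eq_mul, coeff_mul] at hk
    obtain ⟨⟨c₁, c₂⟩, hc, hk⟩ := Finset.exists_ne_zero_of_sum_ne_zero hk
    rw [Finset.HasAntidiagonal.mem_antidiagonal] at hc
    have hk2 : coeff c₂ (F.ε (Finsupp.single k 1)) ≠ 0 := right_ne_zero_of_mul hk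
    have h2 := hdegε k c₂ hk2
    obtain ⟨a, ha, hac⟩ := hsupp _ _ hk2
    have h3 := hS a ha
    have h4 := hS u hu
    have h5 := Finsupp.degree_mono hac
    have h6 := map_add (Finsupp.degree (R := ℕ)) c₁ c₂
    simp only at hc
    rw [hc] at h6
    omega
  have hεS : ∀ k c, coeff c (F.ε (Finsupp.single k 1)) ≠ 0 → c ∈ S := fun k c hc => by
    obtain ⟨a, ha, hac⟩ := hsupp _ _ hc
    have h2 := hdegε k c hc
    rwa [← Finsupp.eq_of_le_of_degree_eq hac (by have := hS a ha; omega)]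
  have hdegd : ∀ j k c, coeff c (F.d 0 (Finsupp.single j 1) k) ≠ 0 → c.degree = 1 :=
    fun j k c hc => by
      have h := F.homogeneous_d 0 j k hc
      rw [weight_standardWeight, he, he] at h
      push_cast at h
      omega
  -- Each basis vector is sent by `F.ε` to a scalar combination of the generators; `lam z` is the
  -- total coefficient that `z` gives to the generator `X^u`.
  let lam : (F.ι 0 →₀ MvPolynomial σ K) → MvPolynomial σ K :=
    fun z => ∑ k, C (coeff u (F.ε (Finsupp.single k 1))) * z k
  have hlin : ∀ j x, x ∈ (u ⊔ v - u).support →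
      coeff (Finsupp.single x 1) (lam (F.d 0 (Finsupp.single j 1))) = 0 := by
    intro j x hx
    have h0 : coeff (u + Finsupp.single x 1) (F.ε (F.d 0 (Finsupp.single j 1))) = 0 := by
      rw [(F.exact_ε _).mpr ⟨_, rfl⟩, coeff_zero]
    rw [F.ε.apply_eq_sum_single, coeff_sum] at h0
    rw [← h0]
    simp only [lam, coeff_sum]
    refine Finset.sum_congr rfl fun k _ => ?_
    rw [coeff_C_mul, mul_comm, smul_eq_mul, coeff_mul,
      Finset.sum_eq_single (Finsupp.single x 1, u)]
    -- Another term would come from a generator dividing `X_x X^u`, hence the lcm. That leaves only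
    -- `X^v`, which `hfar` excludes.
    · rintro ⟨c₁, c₂⟩ hc hne
      rw [Finset.HasAntidiagonal.mem_antidiagonal] at hc
      simp only at hc ⊢
      by_contra hprod
      have h1 := hdegd _ _ _ (left_ne_zero_of_mul hprod)
      have h2 := hεS _ _ (right_ne_zero_of_mul hprod)
      have h3 : c₂ ≤ u + Finsupp.single x 1 := hc ▸ le_add_self
      have h4 : u + Finsupp.single x 1 ≤ u ⊔ v := by
        rw [← add_tsub_cancel_of_le (le_sup_left : u ≤ u ⊔ v)]
        gcongr
        rw [Finsupp.single_le_iff]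
        have := Finsupp.mem_support_iff.mp hx
        omega
      rcases hpair _ h2 (h3.trans h4) with rfl | rfl
      · rw [add_comm] at hc
        exact hne (by rw [add_left_cancel hc])
      · exact hfar x h3
    · intro hc
      exact absurd (by rw [Finset.HasAntidiagonal.mem_antidiagonal, add_comm]) hc
  have hlamadd : ∀ (z : F.ι 0 →₀ MvPolynomial σ K) (p : MvPolynomial σ K),
      lam (p • z) = p * lam z := fun z p => by
    simp only [lam, Finset.mul_sum, Finsupp.smul_apply, smul_eq_mul, mul_left_comm]
  have hlamsum : ∀ (c : F.ι 1 → MvPolynomial σ K) (z : F.ι 1 → (F.ι 0 →₀ MvPolynomial σ K)),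
      lam (∑ j, c j • z j) = ∑ j, c j * lam (z j) := fun c z => by
    simp only [lam, Finset.mul_sum, Finsupp.finsetSum_apply, Finset.mul_sum]
    rw [Finset.sum_comm]
    simp only [Finsupp.smul_apply, smul_eq_mul, mul_left_comm]
  -- Syzygies are combinations of the columns of `F.d 0`, on which `lam` is a linear form free of
  -- the variables dividing `X^(u ⊔ v - u)`.
  have hlamker : ∀ z, F.ε z = 0 → coeff (u ⊔ v - u) (lam z) = 0 := by
    intro z hz
    obtain ⟨y, rfl⟩ := (F.exact_ε z).mp hz
    rw [(F.d 0).apply_eq_sum_single]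
    refine (congrArg _ (hlamsum _ _)).trans ?_
    rw [coeff_sum]
    refine Finset.sum_eq_zero fun j _ => ?_
    rw [coeff_mul]
    refine Finset.sum_eq_zero ?_
    rintro ⟨c₁, c₂⟩ hc
    rw [Finset.HasAntidiagonal.mem_antidiagonal] at hc
    simp only at hc ⊢
    by_contra hprod
    have h2 := right_ne_zero_of_mul hprod
    have hd : c₂.degree = 1 := by
      simp only [lam, coeff_sum, coeff_C_mul] at h2
      obtain ⟨k, -, hk⟩ := Finset.exists_ne_zero_of_sum_ne_zero h2
      exact hdegd _ _ _ (right_ne_zero_of_mul hk)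
    obtain ⟨x, rfl⟩ := Finsupp.exists_eq_single_of_degree_eq_one hd
    refine h2 (hlin j x ?_)
    rw [← hc]
    simp
  -- On the syzygy of the pair, the coefficient that should vanish is `1`: the second summand
  -- contributes only if `u ⊔ v - v ≤ u ⊔ v - u`, and equality of degrees would then force `u = v`.
  have hker : F.ε (monomial (u ⊔ v - u) (1 : K) • g - monomial (u ⊔ v - v) (1 : K) • h) = 0 := by
    rw [map_sub, map_smul, map_smul, hg, hh, smul_eq_mul, smul_eq_mul, monomial_mul, monomial_mul,
      tsub_add_cancel_of_le le_sup_left, tsub_add_cancel_of_le le_sup_right, sub_self]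
  have hcoeff := hlamker _ hker
  have hlamsub : lam (monomial (u ⊔ v - u) (1 : K) • g - monomial (u ⊔ v - v) (1 : K) • h) =
      monomial (u ⊔ v - u) (1 : K) * lam g - monomial (u ⊔ v - v) (1 : K) * lam h := by
    rw [← hlamadd, ← hlamadd]
    simp only [lam, Finsupp.sub_apply, mul_sub, Finset.sum_sub_distrib]
  rw [hlamsub, coeff_sub, coeff_monomial_mul', coeff_monomial_mul', if_pos le_rfl, if_neg,
    tsub_self, sub_zero, one_mul] at hcoeff
  · have h1 : coeff u (F.ε g) = 1 := by
      rw [hg, coeff_monomial, if_pos rfl]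
    rw [F.ε.apply_eq_sum_single, coeff_sum] at h1
    have h2 : coeff u (F.ε g) = coeff 0 (lam g) := by
      rw [F.ε.apply_eq_sum_single, coeff_sum]
      simp only [lam, coeff_sum]
      refine Finset.sum_congr rfl fun k _ => ?_
      rw [coeff_C_mul, mul_comm, smul_eq_mul, coeff_mul, Finset.sum_eq_single (0, u)]
      · rintro ⟨c₁, c₂⟩ hc hne
        rw [Finset.HasAntidiagonal.mem_antidiagonal] at hc
        simp only at hc ⊢
        by_contra hprod
        have h3 := hdegε _ _ (right_ne_zero_of_mul hprod)
        have h4 : c₂ = u := Finsupp.eq_of_le_of_degree_eq (hc ▸ le_add_self)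
          (by have := hS u hu; omega)
        subst h4
        exact hne (by rw [add_eq_right.mp hc])
      · intro hc
        exact absurd (by simp) hc
    rw [← h2, hg] at hcoeff
    simp at hcoeff
  · intro hle
    have h1 : u ⊔ v = (u ⊔ v - v) + v := (tsub_add_cancel_of_le le_sup_right).symm
    have h2 : u ⊔ v = (u ⊔ v - u) + u := (tsub_add_cancel_of_le le_sup_left).symm
    have h3 : (u ⊔ v - v) = u ⊔ v - u := by
      refine Finsupp.eq_of_le_of_degree_eq hle ?_
      have h4 := congrArg Finsupp.degree h1
      have h5 := congrArg Finsupp.degree h2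
      rw [map_add] at h4 h5
      have := hS u hu
      have := hS v hv
      omega
    have h6 : u = v := by
      rw [h3] at h1
      exact add_left_cancel (h2.symm.trans h1)
    exact huv h6

/-! ### Homogeneous lifts and comparison of resolutions -/

theorem MvPolynomial.weightedHomogeneousComponent_mul_of_isWeightedHomogeneous
    {σ K M : Type*} [CommSemiring K] [AddCommGroup M] {wt : σ → M} (p : MvPolynomial σ K)
    {q : MvPolynomial σ K} {b : M} (hq : q.IsWeightedHomogeneous wt b) (a : M) :
    weightedHomogeneousComponent wt a p * q = weightedHomogeneousComponent wt (a + b) (p * q) := by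
  classical
  induction p using MvPolynomial.induction_on' with
  | monomial c r =>
    have h : (monomial c r * q).IsWeightedHomogeneous wt (Finsupp.weight wt c + b) :=
      (isWeightedHomogeneous_monomial wt c r rfl).mul hq
    by_cases hc : Finsupp.weight wt c = a
    · subst hc
      rw [h.weightedHomogeneousComponent_same,
        (isWeightedHomogeneous_monomial wt c r rfl).weightedHomogeneousComponent_same]
    · rw [h.weightedHomogeneousComponent_ne,
        (isWeightedHomogeneous_monomial wt c r rfl).weightedHomogeneousComponent_ne _ (Ne.symm hc), zero_mul]
      exact fun h' => hc (add_right_cancel h').symm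
  | add p₁ p₂ h₁ h₂ => rw [map_add, add_mul, h₁, h₂, add_mul, map_add]

/-- A homogeneous element in the range of a homogeneous map has a homogeneous preimage. -/
theorem exists_isWeightedHomogeneous_preimage {σ K M ι κ : Type*} [Field K] [AddCommGroup M]
    {wt : σ → M} [Finite ι] {s : ι → M} {t : κ → M}
    (f : (ι →₀ MvPolynomial σ K) →ₗ[MvPolynomial σ K] (κ →₀ MvPolynomial σ K))
    (hf : ∀ j k, (f (Finsupp.single j 1) k).IsWeightedHomogeneous wt (s j - t k))
    {y : κ →₀ MvPolynomial σ K} {a : M} (hy : ∀ k, (y k).IsWeightedHomogeneous wt (a - t k))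
    (hyf : y ∈ LinearMap.range f) :
    ∃ x, f x = y ∧ ∀ j, (x j).IsWeightedHomogeneous wt (a - s j) := by
  have := Fintype.ofFinite ι
  obtain ⟨x, rfl⟩ := hyf
  refine ⟨Finsupp.equivFunOnFinite.symm fun j => weightedHomogeneousComponent wt (a - s j) (x j),
    ?_, fun j => weightedHomogeneousComponent_isWeightedHomogeneous _ _⟩
  ext1 k
  rw [← (hy k).weightedHomogeneousComponent_same, f.apply_eq_sum_single, f.apply_eq_sum_single x]
  simp only [Finsupp.finsetSum_apply, Finsupp.smul_apply, smul_eq_mul, map_sum]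
  refine Finset.sum_congr rfl fun j _ => ?_
  rw [Finsupp.equivFunOnFinite_symm_apply_apply,
    weightedHomogeneousComponent_mul_of_isWeightedHomogeneous _ (hf j k), sub_add_sub_cancel]

theorem exists_isWeightedHomogeneous_preimage_of_scalar {σ K M ι : Type*} [Field K]
    [AddCommGroup M] {wt : σ → M} [Finite ι] {s : ι → M}
    (f : (ι →₀ MvPolynomial σ K) →ₗ[MvPolynomial σ K] MvPolynomial σ K)
    (hf : ∀ j, (f (Finsupp.single j 1)).IsWeightedHomogeneous wt (s j))
    {y : MvPolynomial σ K} {a : M} (hy : y.IsWeightedHomogeneous wt a)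
    (hyf : y ∈ LinearMap.range f) :
    ∃ x, f x = y ∧ ∀ j, (x j).IsWeightedHomogeneous wt (a - s j) := by
  have := Fintype.ofFinite ι
  obtain ⟨x, rfl⟩ := hyf
  refine ⟨Finsupp.equivFunOnFinite.symm fun j => weightedHomogeneousComponent wt (a - s j) (x j),
    ?_, fun j => weightedHomogeneousComponent_isWeightedHomogeneous _ _⟩
  rw [← hy.weightedHomogeneousComponent_same, f.apply_eq_sum_single, f.apply_eq_sum_single x]
  simp only [smul_eq_mul, map_sum]
  refine Finset.sum_congr rfl fun j _ => ?_
  rw [Finsupp.equivFunOnFinite_symm_apply_apply,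
    weightedHomogeneousComponent_mul_of_isWeightedHomogeneous _ (hf j), sub_add_cancel]

/-- Homogeneity, of degree zero, of a map between graded free modules. -/
def IsHomogeneousMap {σ K M ι κ : Type*} [Field K] [AddCommGroup M] (wt : σ → M) (s : ι → M)
    (t : κ → M)
    (f : (ι →₀ MvPolynomial σ K) →ₗ[MvPolynomial σ K] (κ →₀ MvPolynomial σ K)) : Prop :=
  ∀ j k, (f (Finsupp.single j 1) k).IsWeightedHomogeneous wt (s j - t k)

theorem IsHomogeneousMap.apply {σ K M ι κ : Type*} [Field K] [AddCommGroup M] {wt : σ → M}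
    {s : ι → M} {t : κ → M} [Finite ι]
    {f : (ι →₀ MvPolynomial σ K) →ₗ[MvPolynomial σ K] (κ →₀ MvPolynomial σ K)}
    (hf : IsHomogeneousMap wt s t f) {x : ι →₀ MvPolynomial σ K} {a : M}
    (hx : ∀ j, (x j).IsWeightedHomogeneous wt (a - s j)) (k : κ) :
    (f x k).IsWeightedHomogeneous wt (a - t k) := by
  have := Fintype.ofFinite ι
  rw [f.apply_eq_sum_single]
  simp only [Finsupp.finsetSum_apply, Finsupp.smul_apply, smul_eq_mul]
  refine IsWeightedHomogeneous.sum _ _ _ fun j _ => ?_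
  rw [← sub_add_sub_cancel a (s j) (t k)]
  exact (hx j).mul (hf j k)

theorem exists_homogeneous_lift {σ K M ι κ l : Type*} [Field K] [AddCommGroup M]
    {wt : σ → M} [Finite ι] [Finite κ] {s : ι → M} {t : κ → M} {r : l → M}
    {f : (κ →₀ MvPolynomial σ K) →ₗ[MvPolynomial σ K] (l →₀ MvPolynomial σ K)}
    {g : (ι →₀ MvPolynomial σ K) →ₗ[MvPolynomial σ K] (l →₀ MvPolynomial σ K)}
    (hf : IsHomogeneousMap wt t r f) (hg : IsHomogeneousMap wt s r g)
    (hgf : ∀ x, g x ∈ LinearMap.range f) :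
    ∃ h : (ι →₀ MvPolynomial σ K) →ₗ[MvPolynomial σ K] (κ →₀ MvPolynomial σ K),
      f ∘ₗ h = g ∧ IsHomogeneousMap wt s t h := by
  choose x hx hx' using fun j => exists_isWeightedHomogeneous_preimage f hf (hg j) (hgf _)
  refine ⟨Finsupp.linearCombination _ x, ?_, fun j k => ?_⟩
  · ext1 j
    ext1
    simp [hx]
  · simpa using hx' j k

theorem exists_linear_lift {R ι N N' : Type*} [CommRing R] [AddCommGroup N] [Module R N]
    [AddCommGroup N'] [Module R N'] {f : N →ₗ[R] N'} {g : (ι →₀ R) →ₗ[R] N'}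
    (hgf : ∀ x, g x ∈ LinearMap.range f) : ∃ h : (ι →₀ R) →ₗ[R] N, f ∘ₗ h = g := by
  choose x hx using fun j => hgf (Finsupp.single j 1)
  refine ⟨Finsupp.linearCombination _ x, ?_⟩
  ext1 j
  ext1
  simp [hx]

theorem isHomogeneousMap_comp {σ K M ι κ l : Type*} [Field K] [AddCommGroup M]
    {wt : σ → M} [Finite κ] {s : ι → M} {t : κ → M} {r : l → M}
    {f : (κ →₀ MvPolynomial σ K) →ₗ[MvPolynomial σ K] (l →₀ MvPolynomial σ K)}
    {g : (ι →₀ MvPolynomial σ K) →ₗ[MvPolynomial σ K] (κ →₀ MvPolynomial σ K)}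
    (hf : IsHomogeneousMap wt t r f) (hg : IsHomogeneousMap wt s t g) :
    IsHomogeneousMap wt s r (f ∘ₗ g) := fun j k => hf.apply (hg j) k

/-- The second shifts of a minimal resolution occur in every graded free resolution. -/
theorem GradedFreeResolution.IsMinimal.exists_shift_two_eq {σ K M : Type*} [Field K]
    [AddCommGroup M] {wt : σ → M} {I : Ideal (MvPolynomial σ K)} {F : GradedFreeResolution wt I}
    (hF : F.IsMinimal) (G : GradedFreeResolution wt I) (j : F.ι 2) :
    ∃ k, G.shift 2 k = F.shift 2 j := by
  have := F.finite
  have := G.finite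
  have hFd : ∀ i, F.d i ∘ₗ F.d (i + 1) = 0 := fun i =>
    LinearMap.ext fun x => (F.exact_d i _).mpr ⟨x, rfl⟩
  have hGd : ∀ i, G.d i ∘ₗ G.d (i + 1) = 0 := fun i =>
    LinearMap.ext fun x => (G.exact_d i _).mpr ⟨x, rfl⟩
  have hFε : F.ε ∘ₗ F.d 0 = 0 := LinearMap.ext fun x => (F.exact_ε _).mpr ⟨x, rfl⟩
  have hGε : G.ε ∘ₗ G.d 0 = 0 := LinearMap.ext fun x => (G.exact_ε _).mpr ⟨x, rfl⟩
  have hFG : LinearMap.range F.ε = LinearMap.range G.ε := by rw [F.range_ε, G.range_ε]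
  obtain ⟨φ₀, hφ₀, hφ₀'⟩ : ∃ φ : (F.ι 0 →₀ MvPolynomial σ K) →ₗ[MvPolynomial σ K]
      (G.ι 0 →₀ MvPolynomial σ K), G.ε ∘ₗ φ = F.ε ∧
        IsHomogeneousMap wt (F.shift 0) (G.shift 0) φ := by
    choose x hx hx' using fun j => exists_isWeightedHomogeneous_preimage_of_scalar G.ε
      G.homogeneous_ε (F.homogeneous_ε j) (hFG ▸ LinearMap.mem_range_self _ _)
    refine ⟨Finsupp.linearCombination _ x, ?_, fun j k => ?_⟩
    · ext1 j
      ext1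
      simp [hx]
    · simpa using hx' j k
  obtain ⟨φ₁, hφ₁, hφ₁'⟩ := exists_homogeneous_lift (f := G.d 0) (g := φ₀ ∘ₗ F.d 0)
    (G.homogeneous_d 0) (isHomogeneousMap_comp hφ₀' (F.homogeneous_d 0)) fun x => by
      refine (G.exact_ε _).mp ?_
      rw [← LinearMap.comp_apply, ← LinearMap.comp_assoc, hφ₀, hFε, LinearMap.zero_apply]
  obtain ⟨φ₂, hφ₂, hφ₂'⟩ := exists_homogeneous_lift (f := G.d 1) (g := φ₁ ∘ₗ F.d 1)
    (G.homogeneous_d 1) (isHomogeneousMap_comp hφ₁' (F.homogeneous_d 1)) fun x => by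
      refine (G.exact_d 0 _).mp ?_
      rw [← LinearMap.comp_apply, ← LinearMap.comp_assoc, hφ₁, LinearMap.comp_assoc, hFd,
        LinearMap.comp_zero, LinearMap.zero_apply]
  -- The map back need not be homogeneous: the degrees are read off from `φ₂` alone.
  obtain ⟨ψ₀, hψ₀⟩ := exists_linear_lift (f := F.ε) (g := G.ε) fun x => by
    rw [hFG]
    exact LinearMap.mem_range_self _ _
  obtain ⟨ψ₁, hψ₁⟩ := exists_linear_lift (f := F.d 0) (g := ψ₀ ∘ₗ G.d 0) fun x => by
    refine (F.exact_ε _).mp ?_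
    rw [← LinearMap.comp_apply, ← LinearMap.comp_assoc, hψ₀, hGε, LinearMap.zero_apply]
  obtain ⟨ψ₂, hψ₂⟩ := exists_linear_lift (f := F.d 1) (g := ψ₁ ∘ₗ G.d 1) fun x => by
    refine (F.exact_d 0 _).mp ?_
    rw [← LinearMap.comp_apply, ← LinearMap.comp_assoc, hψ₁, LinearMap.comp_assoc, hGd,
      LinearMap.comp_zero, LinearMap.zero_apply]
  have eφ₀ := fun x => LinearMap.congr_fun hφ₀ x
  have eφ₁ := fun x => LinearMap.congr_fun hφ₁ x
  have eφ₂ := fun x => LinearMap.congr_fun hφ₂ x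
  have eψ₀ := fun x => LinearMap.congr_fun hψ₀ x
  have eψ₁ := fun x => LinearMap.congr_fun hψ₁ x
  have eψ₂ := fun x => LinearMap.congr_fun hψ₂ x
  simp only [LinearMap.comp_apply] at eφ₀ eφ₁ eφ₂ eψ₀ eψ₁ eψ₂
  -- A homotopy from `ψ ∘ φ` to the identity, built degree by degree.
  obtain ⟨h₀, hh₀⟩ := exists_linear_lift (f := F.d 0) (g := LinearMap.id - ψ₀ ∘ₗ φ₀) fun x => by
    refine (F.exact_ε _).mp ?_
    simp [eφ₀, eψ₀]
  have eh₀ := fun x => LinearMap.congr_fun hh₀ x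
  simp only [LinearMap.comp_apply, LinearMap.sub_apply, LinearMap.id_apply] at eh₀
  obtain ⟨h₁, hh₁⟩ := exists_linear_lift (f := F.d 1)
    (g := LinearMap.id - ψ₁ ∘ₗ φ₁ - h₀ ∘ₗ F.d 0) fun x => by
      refine (F.exact_d 0 _).mp ?_
      simp [eφ₁, eψ₁, eh₀]
  have eh₁ := fun x => LinearMap.congr_fun hh₁ x
  simp only [LinearMap.comp_apply, LinearMap.sub_apply, LinearMap.id_apply] at eh₁
  obtain ⟨h₂, hh₂⟩ := exists_linear_lift (f := F.d 2)
    (g := LinearMap.id - ψ₂ ∘ₗ φ₂ - h₁ ∘ₗ F.d 1) fun x => by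
      refine (F.exact_d 1 _).mp ?_
      have h := LinearMap.congr_fun (hFd 0) x
      simp only [LinearMap.comp_apply, LinearMap.zero_apply] at h
      simp [eφ₂, eψ₂, eh₁, h]
  -- Modulo the variables the homotopy terms vanish by minimality, so the `(j, j)` entry of `ψ₂ ∘
  -- φ₂` has constant term `1`. Some entry `(k, j)` of `φ₂` then has a nonzero constant term, and
  -- homogeneity makes its degree zero.
  have eh₂ := congrArg (fun y => constantCoeff (y j))
    (LinearMap.congr_fun hh₂ (Finsupp.single j 1))
  have := Fintype.ofFinite (G.ι 2)
  have := Fintype.ofFinite (F.ι 1)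
  have := Fintype.ofFinite (F.ι 3)
  simp only [LinearMap.comp_apply, LinearMap.sub_apply, LinearMap.id_apply, Finsupp.sub_apply,
    Finsupp.single_eq_same, map_sub, map_one] at eh₂
  rw [(F.d 2).apply_eq_sum_single, h₁.apply_eq_sum_single (F.d 1 _),
    ψ₂.apply_eq_sum_single] at eh₂
  simp only [Finsupp.finsetSum_apply, Finsupp.smul_apply, smul_eq_mul, map_sum, map_mul, hF 2,
    hF 1, mul_zero, zero_mul, Finset.sum_const_zero, sub_zero] at eh₂
  have hne : ∑ k, constantCoeff (φ₂ (Finsupp.single j 1) k) *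
      constantCoeff (ψ₂ (Finsupp.single k 1) j) ≠ 0 := by
    intro h
    rw [h, sub_zero] at eh₂
    exact zero_ne_one eh₂
  obtain ⟨k, -, hk⟩ := Finset.exists_ne_zero_of_sum_ne_zero hne
  refine ⟨k, ?_⟩
  have h := hφ₂' j k (left_ne_zero_of_mul hk)
  rw [map_zero] at h
  exact (sub_eq_zero.mp h.symm).symm

/-! ### Weighted simplicial boundaries and cones -/

section Boundary

variable {σ τ R : Type*} [LinearOrder τ] [CommRing R]

/-- The sign with which `C` occurs in the boundary of the simplex `insert x C`. -/
def faceSign (r : σ → τ) (x : σ) (C : Finset σ) : ℤ := (-1) ^ (C.filter fun y => r y < r x).card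

theorem faceSign_mul_self (r : σ → τ) (x : σ) (C : Finset σ) :
    faceSign r x C * faceSign r x C = 1 := by
  rw [faceSign, ← mul_pow]
  simp

variable [DecidableEq σ]

theorem faceSign_insert (r : σ → τ) {x y : σ} {C : Finset σ} (hx : x ∉ C) :
    faceSign r y (insert x C) = (if r x < r y then -1 else 1) * faceSign r y C := by
  unfold faceSign
  rw [Finset.filter_insert]
  split_ifs
  · rw [Finset.card_insert_of_notMem (by simp [hx]), pow_succ']
  · rw [one_mul]

/-- Exactly one of `x`, `y` precedes the other, so exactly one of the two signs changes when the
other vertex is inserted. -/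
theorem faceSign_mul_faceSign_insert {r : σ → τ} (hr : Function.Injective r) {x y : σ}
    {C : Finset σ} (hx : x ∉ C) (hy : y ∉ C) (hxy : x ≠ y) :
    faceSign r x C * faceSign r y (insert x C) = -(faceSign r y C * faceSign r x (insert y C)) := by
  rw [faceSign_insert r hx, faceSign_insert r hy]
  rcases lt_or_gt_of_ne (hr.ne hxy) with h | h
  · rw [if_pos h, if_neg h.not_gt]
    ring
  · rw [if_neg h.not_gt, if_pos h]
    ring

variable [Fintype σ]

/-- The simplicial boundary, in which the face opposite to the vertex `x` has weight `c x`. -/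
def boundary (r : σ → τ) (c : σ → R) (z : Finset σ → R) (C : Finset σ) : R :=
  ∑ x ∈ Cᶜ, faceSign r x C • (c x * z (insert x C))

theorem boundary_boundary {r : σ → τ} (hr : Function.Injective r) (c : σ → R)
    (z : Finset σ → R) (C : Finset σ) : boundary r c (boundary r c z) C = 0 := by
  have h : boundary r c (boundary r c z) C = ∑ q ∈ Cᶜ.offDiag,
      (faceSign r q.1 C * faceSign r q.2 (insert q.1 C)) •
        (c q.1 * c q.2 * z (insert q.2 (insert q.1 C))) := by
    rw [Finset.sum_finset_product' (s := Cᶜ) (t := fun x => (insert x C)ᶜ)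
      (f := fun x y => (faceSign r x C * faceSign r y (insert x C)) •
        (c x * c y * z (insert y (insert x C))))]
    · unfold boundary
      refine Finset.sum_congr rfl fun x _ => ?_
      rw [Finset.mul_sum, Finset.smul_sum]
      refine Finset.sum_congr rfl fun y _ => ?_
      rw [mul_smul_comm, smul_smul, mul_assoc]
    · rintro ⟨x, y⟩
      simp only [Finset.mem_offDiag, Finset.mem_compl, Finset.mem_insert, not_or]
      tauto
  rw [h]
  refine Finset.sum_involution (fun q _ => q.swap) ?_ ?_ ?_ ?_
  · rintro ⟨x, y⟩ hq
    simp only [Finset.mem_offDiag, Finset.mem_compl] at hq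
    simp only [Prod.swap_prod_mk]
    rw [faceSign_mul_faceSign_insert hr hq.1 hq.2.1 hq.2.2, Finset.insert_comm, mul_comm (c x),
      neg_smul, neg_add_cancel]
  · rintro ⟨x, y⟩ hq - heq
    simp only [Finset.mem_offDiag] at hq
    simp only [Prod.swap_prod_mk, Prod.mk.injEq] at heq
    exact hq.2.2 heq.2
  · rintro ⟨x, y⟩ hq
    simp only [Finset.mem_offDiag] at hq ⊢
    exact ⟨hq.2.1, hq.1, hq.2.2.symm⟩
  · rintro ⟨x, y⟩ _
    rfl

theorem boundary_sub (r : σ → τ) (c : σ → R) (z w : Finset σ → R) :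
    boundary r c (z - w) = boundary r c z - boundary r c w := by
  ext C
  simp only [boundary, Pi.sub_apply, mul_sub, smul_sub, Finset.sum_sub_distrib]

theorem boundary_add (r : σ → τ) (c : σ → R) (z w : Finset σ → R) :
    boundary r c (z + w) = boundary r c z + boundary r c w := by
  ext C
  simp only [boundary, Pi.add_apply, mul_add, smul_add, Finset.sum_add_distrib]

theorem boundary_smul (r : σ → τ) (c : σ → R) (a : R) (z : Finset σ → R) :
    boundary r c (a • z) = a • boundary r c z := by
  ext C
  simp only [boundary, Pi.smul_apply, smul_eq_mul, Finset.mul_sum, mul_smul_comm]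
  exact Finset.sum_congr rfl fun x _ => by rw [mul_left_comm]

/-- The cone over a chain, with apex `v`. -/
def cone (r : σ → τ) (v : σ) (z : Finset σ → R) (A : Finset σ) : R :=
  if v ∈ A then faceSign r v (A.erase v) • z (A.erase v) else 0

/-- The cone is a contracting homotopy of the full simplex, the empty face included. The term at the
apex gives back `z C`; when `v ∈ C` the remaining terms cancel in pairs. -/
theorem boundary_cone_add {r : σ → τ} (hr : Function.Injective r) (v : σ) (z : Finset σ → R)
    (C : Finset σ) :
    boundary r 1 (cone r v z) C + cone r v (boundary r 1 z) C = z C := by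
  by_cases hv : v ∈ C
  · obtain ⟨D, hvD, rfl⟩ : ∃ D, v ∉ D ∧ C = insert v D :=
      ⟨C.erase v, Finset.notMem_erase v C, (Finset.insert_erase hv).symm⟩
    have hc : Dᶜ = insert v (insert v D)ᶜ := by
      ext x
      by_cases hx : x = v
      · simp [hx, hvD]
      · simp [hx]
    rw [cone, if_pos (Finset.mem_insert_self v D), Finset.erase_insert hvD, boundary, boundary, hc,
      Finset.sum_insert (by simp), smul_add, smul_smul]
    simp only [Pi.one_apply, one_mul]
    rw [faceSign_mul_self, one_smul, add_left_comm, Finset.smul_sum, ← Finset.sum_add_distrib,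
      Finset.sum_eq_zero, add_zero]
    intro x hx
    simp only [Finset.mem_compl, Finset.mem_insert, not_or] at hx
    rw [cone, if_pos (by simp), Finset.insert_comm, Finset.erase_insert (by simp [hvD, Ne.symm hx.1]),
      smul_smul, smul_smul, ← add_smul]
    have h1 := faceSign_mul_faceSign_insert hr hvD hx.2 (Ne.symm hx.1)
    have h2 := faceSign_mul_self r v D
    have h3 := faceSign_mul_self r v (insert x D)
    have h4 : faceSign r x (insert v D) * faceSign r v (insert x D) +
        faceSign r v D * faceSign r x D = 0 := by
      linear_combination faceSign r v (insert x D) * faceSign r v D * h1 -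
        faceSign r x (insert v D) * faceSign r v (insert x D) * h2 -
        faceSign r v D * faceSign r x D * h3
    rw [h4, zero_smul]
  · rw [show cone r v (boundary r 1 z) C = 0 from if_neg hv, add_zero, boundary,
      Finset.sum_eq_single v]
    · rw [cone, if_pos (Finset.mem_insert_self v C), Finset.erase_insert hv, Pi.one_apply, one_mul,
        smul_smul, faceSign_mul_self, one_smul]
    · intro x _ hx
      rw [cone, if_neg (by simp [hv, Ne.symm hx]), mul_zero, smul_zero]
    · simp [hv]

end Boundary

/-! ### Cells and their relative cycles -/

section Cells

variable {m n : ℕ}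

/-- The cells: chains in `[m] × [n]` that meet every row `{p} × [n]`. -/
def IsCell (A : Finset (Fin m × Fin n)) : Prop :=
  (∀ x ∈ A, ∀ y ∈ A, x ≤ y ∨ y ≤ x) ∧ ∀ p, ∃ a, (p, a) ∈ A

/-- Being a chain passes to subsets and meeting every row passes to supersets. Hence a non-cell
containing a cell is not a chain and lies in no cell, which is why non-cells can be discarded
without spoiling the boundary at cells. -/
theorem IsCell.of_subset_of_subset {A C D : Finset (Fin m × Fin n)} (hA : IsCell A)
    (hC : IsCell C) (hCD : C ⊆ D) (hDA : D ⊆ A) : IsCell D :=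
  ⟨fun x hx y hy => hA.1 x (hDA hx) y (hDA hy),
    fun p => (hC.2 p).imp fun _ ha => hCD ha⟩

theorem boundary_eq_zero_of_not_isCell {τ R : Type*} [LinearOrder τ] [CommRing R]
    {r : Fin m × Fin n → τ} {c : Fin m × Fin n → R} {z : Finset (Fin m × Fin n) → R}
    (hz : ∀ A, z A ≠ 0 → IsCell A) {C D : Finset (Fin m × Fin n)} (hC : IsCell C) (hCD : C ⊆ D)
    (hD : ¬ IsCell D) : boundary r c z D = 0 := by
  refine Finset.sum_eq_zero fun x _ => ?_
  have h : z (insert x D) = 0 := not_ne_iff.mp fun h =>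
    hD ((hz _ h).of_subset_of_subset hC hCD (Finset.subset_insert x D))
  rw [h, mul_zero, smul_zero]

open Classical in
/-- Removes the terms that are not cells. -/
noncomputable def cellPart {R : Type*} [Zero R] (z : Finset (Fin m × Fin n) → R)
    (A : Finset (Fin m × Fin n)) : R := if IsCell A then z A else 0

theorem boundary_cellPart_boundary {τ R : Type*} [LinearOrder τ] [CommRing R]
    {r : Fin m × Fin n → τ} (hr : Function.Injective r) (c : Fin m × Fin n → R)
    {z : Finset (Fin m × Fin n) → R} (hz : ∀ A, z A ≠ 0 → IsCell A) {C : Finset (Fin m × Fin n)}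
    (hC : IsCell C) : boundary r c (cellPart (boundary r c z)) C = 0 := by
  rw [← boundary_boundary hr c z C]
  refine Finset.sum_congr rfl fun x _ => ?_
  rw [cellPart]
  split_ifs with h
  · rfl
  · rw [boundary_eq_zero_of_not_isCell hz hC (Finset.subset_insert x C) h]

variable {τ R : Type*} [LinearOrder τ] [CommRing R] {r : Fin m × Fin n → τ}

theorem boundary_support {c : Fin m × Fin n → R} {w : Finset (Fin m × Fin n) → R}
    {C : Finset (Fin m × Fin n)} (h : boundary r c w C ≠ 0) :
    ∃ x ∉ C, w (insert x C) ≠ 0 := by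
  obtain ⟨x, hx, hne⟩ := Finset.exists_ne_zero_of_sum_ne_zero h
  exact ⟨x, by simpa using hx, fun h0 => hne (by rw [h0, mul_zero, smul_zero])⟩

/-- A relative cycle whose cells are single prescribed points in the rows before `p` is
homologous to one with the same property for the rows up to `p`. -/
theorem exists_boundary_straighten_row (hr : Function.Injective r)
    {B : Finset (Fin m × Fin n)} {k : ℕ} {z : Finset (Fin m × Fin n) → R}
    (hz : ∀ A, z A ≠ 0 → IsCell A ∧ A ⊆ B ∧ A.card = k)
    (hcyc : ∀ C, IsCell C → boundary r 1 z C = 0) (p : Fin m) (g : Fin m → Fin n)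
    (hg : ∀ A, z A ≠ 0 → ∀ q < p, ∀ a, (q, a) ∈ A → a = g q) :
    ∃ w : Finset (Fin m × Fin n) → R,
      (∀ A, w A ≠ 0 → IsCell A ∧ A ⊆ B ∧ A.card = k + 1) ∧
      ∃ g' : Fin m → Fin n, ∀ C, IsCell C → (z - boundary r 1 w) C ≠ 0 →
        ∀ q ≤ p, ∀ a, (q, a) ∈ C → a = g' q := by
  classical
  by_cases hz0 : ∀ A, z A = 0
  · refine ⟨0, by simp, g, fun C _ hC => (hC ?_).elim⟩
    simp [boundary, hz0]
  push Not at hz0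
  obtain ⟨A₁, hA₁⟩ := hz0
  obtain ⟨b, hb⟩ := (hz A₁ hA₁).1.2 p
  -- `f` is the lowest column used in row `p` by any cell in the support of `z`; `(p, f)` will be
  -- the apex of a cone.
  obtain ⟨f, ⟨A₀, hA₀, hfA₀⟩, hfmin⟩ : ∃ f, (∃ A, z A ≠ 0 ∧ (p, f) ∈ A) ∧
      ∀ a, (∃ A, z A ≠ 0 ∧ (p, a) ∈ A) → f ≤ a := by
    let T : Finset (Fin n) := Finset.univ.filter fun a => ∃ A, z A ≠ 0 ∧ (p, a) ∈ A
    have hT : T.Nonempty := ⟨b, by simpa [T] using ⟨A₁, hA₁, hb⟩⟩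
    refine ⟨T.min' hT, ?_, fun a ha => T.min'_le a (by simpa [T] using ha)⟩
    have := T.min'_mem hT
    simpa [T] using this
  have hcone : ∀ A, cone r (p, f) z A ≠ 0 → (p, f) ∈ A ∧ z (A.erase (p, f)) ≠ 0 := by
    intro A hA
    rw [cone] at hA
    split_ifs at hA with h
    · exact ⟨h, fun h0 => hA (by rw [h0, smul_zero])⟩
    · exact (hA rfl).elim
  -- The apex can be added to every cell of `z`. Points in earlier rows are shared with `A₀`, which
  -- contains the apex; the points of row `p` lie above it by minimality, and later points lie above
  -- a point of row `p`.
  have hcomp : ∀ A, z A ≠ 0 → ∀ y ∈ A, (p, f) ≤ y ∨ y ≤ (p, f) := by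
    rintro A hA ⟨q, a⟩ hy
    rcases lt_trichotomy q p with hq | rfl | hq
    · right
      obtain ⟨a', ha'⟩ := (hz A₀ hA₀).1.2 q
      have h1 : a' = a := (hg A₀ hA₀ q hq a' ha').trans (hg A hA q hq a hy).symm
      rw [h1] at ha'
      rcases (hz A₀ hA₀).1.1 _ ha' _ hfA₀ with h | h
      · exact h
      · exact absurd h.1 (not_le.mpr hq)
    · exact Or.inl ⟨le_rfl, hfmin a ⟨A, hA, hy⟩⟩
    · left
      obtain ⟨a', ha'⟩ := (hz A hA).1.2 p
      rcases (hz A hA).1.1 _ ha' _ hy with h | h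
      · exact ⟨hq.le, (hfmin a' ⟨A, hA, ha'⟩).trans h.2⟩
      · exact absurd h.1 (not_le.mpr hq)
  refine ⟨cone r (p, f) z, ?_, Function.update g p f, ?_⟩
  · intro A hA
    obtain ⟨hv, hA'⟩ := hcone A hA
    obtain ⟨hc, hB, hk⟩ := hz _ hA'
    refine ⟨⟨?_, fun q => (hc.2 q).imp fun _ h => Finset.mem_of_mem_erase h⟩, ?_, ?_⟩
    · intro x hx y hy
      by_cases hx' : x = (p, f) <;> by_cases hy' : y = (p, f)
      · exact Or.inl (hx'.trans hy'.symm).le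
      · exact hx' ▸ hcomp _ hA' y (Finset.mem_erase.mpr ⟨hy', hy⟩)
      · exact hy' ▸ (hcomp _ hA' x (Finset.mem_erase.mpr ⟨hx', hx⟩)).symm
      · exact hc.1 _ (Finset.mem_erase.mpr ⟨hx', hx⟩) _ (Finset.mem_erase.mpr ⟨hy', hy⟩)
    · rw [← Finset.insert_erase hv]
      exact Finset.insert_subset ((hz A₀ hA₀).2.1 hfA₀) hB
    · rw [← Finset.insert_erase hv, Finset.card_insert_of_notMem (Finset.notMem_erase _ _), hk]
  · intro C hC hne
    have h1 : (z - boundary r 1 (cone r (p, f) z)) C = cone r (p, f) (boundary r 1 z) C := by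
      rw [Pi.sub_apply, sub_eq_iff_eq_add', boundary_cone_add hr]
    rw [h1, cone] at hne
    split_ifs at hne with hv
    swap
    · exact (hne rfl).elim
    have hne' : boundary r 1 z (C.erase (p, f)) ≠ 0 := fun h0 => hne (by rw [h0, smul_zero])
    -- What survives is the cone over the boundary of `z`, which lives on non-cells. Removing the
    -- apex from `C` therefore empties row `p`, so `C` meets this row in the apex only.
    have hnot : ¬ IsCell (C.erase (p, f)) := fun h => hne' (hcyc _ h)
    have hrow : ∀ a, (p, a) ∉ C.erase (p, f) := by
      intro a ha
      refine hnot ⟨fun x hx y hy => hC.1 x (Finset.mem_of_mem_erase hx) y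
        (Finset.mem_of_mem_erase hy), fun q => ?_⟩
      by_cases hq : q = p
      · exact ⟨a, hq ▸ ha⟩
      · obtain ⟨a', ha'⟩ := hC.2 q
        exact ⟨a', Finset.mem_erase.mpr ⟨by simp [hq], ha'⟩⟩
    obtain ⟨x, -, hx⟩ := boundary_support hne'
    intro q hq a ha
    rcases hq.lt_or_eq with hq | rfl
    · rw [Function.update_of_ne hq.ne]
      exact hg _ hx q hq a (Finset.mem_insert_of_mem
        (Finset.mem_erase.mpr ⟨by simp [hq.ne], ha⟩))
    · rw [Function.update_self]
      by_contra hne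
      exact hrow a (Finset.mem_erase.mpr ⟨by simp [hne], ha⟩)

/-- Induction on the rows. Before the next row is treated, the non-cell terms of `z - boundary r 1
w` are dropped, which leaves a relative cycle by `boundary_cellPart_boundary`. -/
theorem exists_boundary_straighten (hr : Function.Injective r)
    {B : Finset (Fin m × Fin n)} {k : ℕ} {z : Finset (Fin m × Fin n) → R}
    (hz : ∀ A, z A ≠ 0 → IsCell A ∧ A ⊆ B ∧ A.card = k)
    (hcyc : ∀ C, IsCell C → boundary r 1 z C = 0) (hg : Nonempty (Fin m → Fin n)) :
    ∀ p ≤ m, ∃ w : Finset (Fin m × Fin n) → R,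
      (∀ A, w A ≠ 0 → IsCell A ∧ A ⊆ B ∧ A.card = k + 1) ∧
      ∃ g : Fin m → Fin n, ∀ C, IsCell C → (z - boundary r 1 w) C ≠ 0 →
        ∀ q : Fin m, q.val < p → ∀ a, (q, a) ∈ C → a = g q := by
  classical
  intro p
  induction p with
  | zero => exact fun _ => ⟨0, by simp, hg.some, by simp⟩
  | succ p ih =>
    intro hp
    obtain ⟨w, hw, g, hwg⟩ := ih (by omega)
    have hsupp : ∀ A, cellPart (z - boundary r 1 w) A ≠ 0 →
        IsCell A ∧ (z - boundary r 1 w) A ≠ 0 := by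
      intro A hA
      rw [cellPart] at hA
      split_ifs at hA with h
      · exact ⟨h, hA⟩
      · exact (hA rfl).elim
    have hcp : cellPart (z - boundary r 1 w) = z - cellPart (boundary r 1 w) := by
      ext A
      by_cases h : IsCell A
      · simp [cellPart, h]
      · have h0 : z A = 0 := not_ne_iff.mp fun hA => h (hz A hA).1
        simp [cellPart, h, h0]
    have hz' : ∀ A, cellPart (z - boundary r 1 w) A ≠ 0 → IsCell A ∧ A ⊆ B ∧ A.card = k := by
      intro A hA
      obtain ⟨hc, hA⟩ := hsupp A hA
      refine ⟨hc, ?_⟩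
      by_cases h : z A = 0
      · have h2 : boundary r 1 w A ≠ 0 := fun h' => hA (by simp [h, h'])
        obtain ⟨x, hx, hwx⟩ := boundary_support h2
        obtain ⟨-, hB, hk⟩ := hw _ hwx
        rw [Finset.card_insert_of_notMem hx] at hk
        exact ⟨(Finset.subset_insert x A).trans hB, by omega⟩
      · exact (hz A h).2
    have hcyc' : ∀ C, IsCell C → boundary r 1 (cellPart (z - boundary r 1 w)) C = 0 := by
      intro C hC
      rw [hcp, boundary_sub, Pi.sub_apply, hcyc C hC,
        boundary_cellPart_boundary hr 1 (fun A hA => (hw A hA).1) hC, sub_zero]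
    have hg' : ∀ A, cellPart (z - boundary r 1 w) A ≠ 0 →
        ∀ q < (⟨p, hp⟩ : Fin m), ∀ a, (q, a) ∈ A → a = g q := by
      intro A hA q hq a ha
      obtain ⟨hc, hA⟩ := hsupp A hA
      exact hwg A hc hA q hq a ha
    obtain ⟨w', hw', g', hwg'⟩ := exists_boundary_straighten_row hr hz' hcyc' ⟨p, hp⟩ g hg'
    refine ⟨w + w', ?_, g', ?_⟩
    · intro A hA
      by_cases h : w A = 0
      · exact hw' A fun h' => hA (by simp [h, h'])
      · exact hw A h
    · intro C hC hne q hq a ha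
      refine hwg' C hC ?_ q (Nat.lt_succ_iff.mp hq) a ha
      rw [boundary_add] at hne
      rw [Pi.sub_apply, cellPart, if_pos hC]
      simpa [sub_sub] using hne

/-- A relative cycle is homologous to a cycle that is supported on a single graph. -/
theorem exists_boundary_supported_on_graph (hr : Function.Injective r)
    {B : Finset (Fin m × Fin n)} {k : ℕ} {z : Finset (Fin m × Fin n) → R}
    (hz : ∀ A, z A ≠ 0 → IsCell A ∧ A ⊆ B ∧ A.card = k)
    (hcyc : ∀ C, IsCell C → boundary r 1 z C = 0) (hmn : Nonempty (Fin m → Fin n)) :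
    ∃ w : Finset (Fin m × Fin n) → R,
      (∀ A, w A ≠ 0 → IsCell A ∧ A ⊆ B ∧ A.card = k + 1) ∧
      ∃ A₀ : Finset (Fin m × Fin n), A₀.card = m ∧ ∀ C, IsCell C → (z - boundary r 1 w) C ≠ 0 →
        C = A₀ := by
  obtain ⟨w, hw, g, hg⟩ := exists_boundary_straighten hr hz hcyc hmn m le_rfl
  refine ⟨w, hw, Finset.univ.image fun p => (p, g p), ?_, fun C hC hne => ?_⟩
  · rw [Finset.card_image_of_injective _ fun p q h => (Prod.mk.inj h).1, Finset.card_univ,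
      Fintype.card_fin]
  · ext ⟨p, a⟩
    simp only [Finset.mem_image, Finset.mem_univ, true_and, Prod.mk.injEq]
    constructor
    · intro h
      exact ⟨p, rfl, (hg C hC hne p p.2 a h).symm⟩
    · rintro ⟨q, rfl, rfl⟩
      obtain ⟨a, ha⟩ := hC.2 q
      rwa [hg C hC hne q q.2 a ha] at ha

theorem card_le_of_forall_exists_mem {A : Finset (Fin m × Fin n)} (hA : ∀ p, ∃ a, (p, a) ∈ A) :
    m ≤ A.card := by
  have h : (Finset.univ : Finset (Fin m)) ⊆ A.image Prod.fst := fun p _ => by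
    obtain ⟨a, ha⟩ := hA p
    exact Finset.mem_image.mpr ⟨_, ha, rfl⟩
  simpa using (Finset.card_le_card h).trans Finset.card_image_le

open Classical in
-- Exactly one row of `A` has two points, and only their deletions leave cells. They are adjacent in
-- the row-by-row lexicographic order, so their signs are opposite.
theorem IsCell.sum_faceSign_eq_zero {A : Finset (Fin m × Fin n)} (hA : IsCell A)
    (hcard : A.card = m + 1) :
    ∑ x ∈ A with IsCell (A.erase x), faceSign toLex x (A.erase x) = 0 := by
  obtain ⟨p, a, b, ha, hb, hab⟩ : ∃ p a b, (p, a) ∈ A ∧ (p, b) ∈ A ∧ a < b := by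
    obtain ⟨⟨p, a⟩, hx, ⟨q, b⟩, hy, hne, hpq⟩ := Finset.exists_ne_map_eq_of_card_lt_of_maps_to
      (s := A) (t := Finset.univ) (f := Prod.fst) (by simp [hcard]) fun _ _ => Finset.mem_univ _
    obtain rfl : p = q := hpq
    rcases lt_or_gt_of_ne fun h : a = b => hne (by rw [h]) with h | h
    · exact ⟨p, a, b, hx, hy, h⟩
    · exact ⟨p, b, a, hy, hx, h⟩
  have hchain : ∀ t, ∀ x ∈ A.erase t, ∀ y ∈ A.erase t, x ≤ y ∨ y ≤ x := fun t x hx y hy =>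
    hA.1 x (Finset.mem_of_mem_erase hx) y (Finset.mem_of_mem_erase hy)
  have herase : ∀ q c c', (q, c) ∈ A → c ≠ c' → IsCell (A.erase (q, c')) := by
    intro q c c' hc hcc
    refine ⟨hchain _, fun s => ?_⟩
    by_cases hs : s = q
    · exact ⟨c, Finset.mem_erase.mpr ⟨by simp [hcc], hs ▸ hc⟩⟩
    · obtain ⟨d, hd⟩ := hA.2 s
      exact ⟨d, Finset.mem_erase.mpr ⟨by simp [hs], hd⟩⟩
  have hother : ∀ t ∈ A, t ≠ (p, a) → t ≠ (p, b) → ¬ IsCell (A.erase t) := by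
    intro t ht hta htb hcell
    have h1 : ∀ s, ∃ c, (s, c) ∈ (A.erase t).erase (p, a) := by
      intro s
      by_cases hs : s = p
      · exact ⟨b, by simp [hs, hab.ne', htb.symm, hb]⟩
      · obtain ⟨c, hc⟩ := hcell.2 s
        exact ⟨c, Finset.mem_erase.mpr ⟨by simp [hs], hc⟩⟩
    have h2 := card_le_of_forall_exists_mem h1
    rw [Finset.card_erase_of_mem (Finset.mem_erase.mpr ⟨hta.symm, ha⟩),
      Finset.card_erase_of_mem ht] at h2
    have : 0 < m := p.pos
    omega
  have hne : (p, a) ≠ (p, b) := by simp [hab.ne]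
  have hfilter : (A.filter fun x => IsCell (A.erase x)) = {(p, a), (p, b)} := by
    ext t
    simp only [Finset.mem_filter, Finset.mem_insert, Finset.mem_singleton]
    constructor
    · rintro ⟨ht, hcell⟩
      by_contra! h
      exact hother t ht h.1 h.2 hcell
    · rintro (rfl | rfl)
      · exact ⟨ha, herase p b a hb hab.ne'⟩
      · exact ⟨hb, herase p a b ha hab.ne⟩
  obtain ⟨D, hD⟩ : ∃ D, D = (A.erase (p, a)).erase (p, b) := ⟨_, rfl⟩
  have hDa : A.erase (p, a) = insert (p, b) D := by
    rw [hD, Finset.insert_erase (Finset.mem_erase.mpr ⟨hne.symm, hb⟩)]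
  have hDb : A.erase (p, b) = insert (p, a) D := by
    rw [hD, Finset.erase_right_comm, Finset.insert_erase (Finset.mem_erase.mpr ⟨hne, ha⟩)]
  have hlt : toLex (p, a) < toLex (p, b) := Prod.Lex.toLex_lt_toLex.mpr (Or.inr ⟨rfl, hab⟩)
  have hDD : faceSign toLex (p, a) D = faceSign toLex (p, b) D := by
    unfold faceSign
    congr 2
    refine Finset.filter_congr fun t ht => ⟨fun h => h.trans hlt, fun h => ?_⟩
    obtain ⟨s, c⟩ := t
    rw [hD] at ht
    simp only [Finset.mem_erase] at ht
    rcases Prod.Lex.toLex_lt_toLex.mp h with h | ⟨h, -⟩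
    · exact Prod.Lex.toLex_lt_toLex.mpr (Or.inl h)
    · simp only at h
      subst h
      exact (hother _ ht.2.2 ht.2.1 ht.1 (herase s a c ha fun h => ht.2.1 (by rw [h]))).elim
  rw [hfilter, Finset.sum_pair hne, hDa, hDb, faceSign_insert _ (by simp [hD]),
    faceSign_insert _ (by simp [hD]), if_neg hlt.not_gt, if_pos hlt, hDD]
  ring

open Classical in
theorem sum_boundary_eq_zero {w : Finset (Fin m × Fin n) → R}
    (hw : ∀ A, w A ≠ 0 → IsCell A ∧ A.card = m + 1) :
    ∑ C with IsCell C, boundary toLex 1 w C = 0 := by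
  have h : ∑ C with IsCell C, boundary toLex 1 w C =
      ∑ A, ∑ x ∈ A with IsCell (A.erase x), faceSign toLex x (A.erase x) • w A := by
    unfold boundary
    rw [Finset.sum_sigma', Finset.sum_sigma']
    refine Finset.sum_bij' (fun q _ => ⟨insert q.2 q.1, q.2⟩) (fun q _ => ⟨q.1.erase q.2, q.2⟩)
      ?_ ?_ ?_ ?_ ?_
    · rintro ⟨C, x⟩ hq
      simp only [Finset.mem_sigma, Finset.mem_filter, Finset.mem_univ, true_and,
        Finset.mem_compl] at hq ⊢
      exact ⟨Finset.mem_insert_self _ _, by rw [Finset.erase_insert hq.2]; exact hq.1⟩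
    · rintro ⟨C, x⟩ hq
      simp only [Finset.mem_sigma, Finset.mem_filter, Finset.mem_univ, true_and,
        Finset.mem_compl] at hq ⊢
      exact ⟨hq.2, Finset.notMem_erase _ _⟩
    · rintro ⟨C, x⟩ hq
      simp only [Finset.mem_sigma, Finset.mem_compl] at hq
      simp only [Finset.erase_insert hq.2]
    · rintro ⟨C, x⟩ hq
      simp only [Finset.mem_sigma, Finset.mem_filter] at hq
      simp only [Finset.insert_erase hq.2.1]
    · rintro ⟨C, x⟩ hq
      simp only [Finset.mem_sigma, Finset.mem_compl] at hq
      simp only [Finset.erase_insert hq.2, Pi.one_apply, one_mul]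
  rw [h]
  refine Finset.sum_eq_zero fun A _ => ?_
  rw [← Finset.sum_smul]
  by_cases hA : w A = 0
  · rw [hA, smul_zero]
  · rw [(hw A hA).1.sum_faceSign_eq_zero (hw A hA).2, zero_smul]

end Cells

/-! ### Exactness over the scalars -/

section Exactness

variable {m n : ℕ}

open Classical in
-- Up to a boundary, the cycle is supported on one graph, which has `m` points. So nothing remains
-- unless `k = m`, and then the only remaining coefficient is the augmentation, which is zero.
theorem exists_boundary_eq_of_cycle {R : Type*} [CommRing R]
    {B : Finset (Fin m × Fin n)} {k : ℕ} {z : Finset (Fin m × Fin n) → R}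
    (hz : ∀ A, z A ≠ 0 → IsCell A ∧ A ⊆ B ∧ A.card = k)
    (hcyc : ∀ C, IsCell C → boundary toLex 1 z C = 0)
    (hsum : k = m → ∑ C with IsCell C, z C = 0) (hmn : Nonempty (Fin m → Fin n)) :
    ∃ w : Finset (Fin m × Fin n) → R,
      (∀ A, w A ≠ 0 → IsCell A ∧ A ⊆ B ∧ A.card = k + 1) ∧
      ∀ C, IsCell C → boundary toLex 1 w C = z C := by
  obtain ⟨w, hw, A₀, hA₀, hsupp⟩ :=
    exists_boundary_supported_on_graph toLex.injective hz hcyc hmn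
  refine ⟨w, hw, fun C hC => ?_⟩
  by_contra hne
  have hne' : (z - boundary toLex 1 w) C ≠ 0 := fun h => hne (sub_eq_zero.mp h).symm
  obtain rfl := hsupp C hC hne'
  have hk : k = m := by
    by_cases h : z C = 0
    · have h2 : boundary toLex 1 w C ≠ 0 := fun h' => hne' (by simp [h, h'])
      obtain ⟨x, hx, hwx⟩ := boundary_support h2
      have := (hw _ hwx).2.2
      rw [Finset.card_insert_of_notMem hx] at this
      omega
    · have := (hz C h).2.2
      omega
  subst hk
  have h1 : ∑ D with IsCell D, (z - boundary toLex 1 w) D = 0 := by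
    simp only [Pi.sub_apply, Finset.sum_sub_distrib]
    rw [hsum rfl, sum_boundary_eq_zero fun A hA => ⟨(hw A hA).1, (hw A hA).2.2⟩, sub_zero]
  rw [Finset.sum_eq_single C] at h1
  · exact hne' h1
  · intro D hD hDC
    by_contra h
    exact hDC (hsupp D (Finset.mem_filter.mp hD).2 h)
  · intro h
    exact absurd (Finset.mem_filter.mpr ⟨Finset.mem_univ _, hC⟩) h

end Exactness

/-! ### Decomposition into multigraded strands -/

section Strand

variable {σ τ K : Type*} [Fintype σ] [DecidableEq σ] [LinearOrder τ] [Field K]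

/-- The exponent of the squarefree monomial `∏_{x ∈ A} X_x`. -/
noncomputable def indicatorExponent (A : Finset σ) : σ →₀ ℕ :=
  Finsupp.equivFunOnFinite.symm fun x => if x ∈ A then 1 else 0

theorem indicatorExponent_apply (A : Finset σ) (x : σ) :
    indicatorExponent A x = if x ∈ A then 1 else 0 := rfl

theorem indicatorExponent_le_iff {A : Finset σ} {b : σ →₀ ℕ} :
    indicatorExponent A ≤ b ↔ A ⊆ b.support := by
  simp only [Finsupp.le_def, indicatorExponent_apply, Finset.subset_iff, Finsupp.mem_support_iff]
  refine forall_congr' fun x => ?_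
  split_ifs with h
  · simp [h, Nat.one_le_iff_ne_zero]
  · simp [h]

theorem indicatorExponent_insert {x : σ} {C : Finset σ} (hx : x ∉ C) :
    indicatorExponent (insert x C) = indicatorExponent C + Finsupp.single x 1 := by
  ext y
  simp only [indicatorExponent_apply, Finsupp.add_apply, Finsupp.single_apply, Finset.mem_insert]
  by_cases h : y = x
  · subst h
    simp [hx]
  · simp [h, Ne.symm h]

theorem monomial_indicatorExponent (A : Finset σ) :
    (monomial (indicatorExponent A) 1 : MvPolynomial σ K) = ∏ x ∈ A, X x := by
  rw [monomial_eq, map_one, one_mul, Finsupp.prod_fintype _ _ (fun _ => pow_zero _)]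
  simp only [indicatorExponent_apply, pow_ite, pow_one, pow_zero]
  rw [Finset.prod_ite_mem, Finset.univ_inter]

theorem degree_indicatorExponent (A : Finset σ) : (indicatorExponent A).degree = A.card := by
  rw [Finsupp.degree_eq_sum]
  simp [indicatorExponent_apply]

/-- The part of multidegree `b` of a chain with polynomial coefficients, in which a cell `A` has
the multidegree `indicatorExponent A`. -/
noncomputable def strand (b : σ →₀ ℕ) (z : Finset σ → MvPolynomial σ K) (A : Finset σ) : K :=
  if indicatorExponent A ≤ b then coeff (b - indicatorExponent A) (z A) else 0

/-- Multiplication by `X_x` makes up exactly for the multidegree lost by deleting `x`, so in each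
fixed multidegree the weights become `1`. -/
theorem strand_boundary (r : σ → τ) (b : σ →₀ ℕ) (z : Finset σ → MvPolynomial σ K)
    (C : Finset σ) : strand b (boundary r X z) C = boundary r 1 (strand b z) C := by
  rw [strand]
  split_ifs with hC
  · simp only [boundary, coeff_sum, coeff_smul]
    refine Finset.sum_congr rfl fun x hx => ?_
    rw [Finset.mem_compl] at hx
    rw [coeff_X_mul', strand, Pi.one_apply, one_mul, tsub_tsub, ← indicatorExponent_insert hx]
    have h : x ∈ (b - indicatorExponent C).support ↔ indicatorExponent (insert x C) ≤ b := by
      rw [indicatorExponent_le_iff] at hC ⊢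
      rw [Finset.insert_subset_iff, and_iff_left hC]
      simp [indicatorExponent_apply, hx]
    simp only [h]
  · refine (Finset.sum_eq_zero fun x _ => ?_).symm
    rw [strand, if_neg, mul_zero, smul_zero]
    rw [indicatorExponent_le_iff] at hC ⊢
    exact fun h => hC ((Finset.subset_insert x C).trans h)

theorem eq_of_strand_eq {z w : Finset σ → MvPolynomial σ K} {A : Finset σ}
    (h : ∀ b, strand b z A = strand b w A) : z A = w A := by
  ext c
  have := h (c + indicatorExponent A)
  simpa [strand] using this

theorem coeff_sum_mul_monomial (b : σ →₀ ℕ) (z : Finset σ → MvPolynomial σ K)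
    (s : Finset (Finset σ)) :
    coeff b (∑ C ∈ s, z C * monomial (indicatorExponent C) 1) = ∑ C ∈ s, strand b z C := by
  rw [coeff_sum]
  refine Finset.sum_congr rfl fun C _ => ?_
  rw [coeff_mul_monomial', mul_one, strand]

/-- Reassembles a polynomial chain from its strands; the finite set `T` keeps the coefficients
polynomial. -/
theorem exists_strand_eq (T : Finset (σ →₀ ℕ)) (w : (σ →₀ ℕ) → Finset σ → K)
    (hw : ∀ b A, w b A ≠ 0 → A ⊆ b.support) (hT : ∀ b ∉ T, w b = 0) :
    ∃ W : Finset σ → MvPolynomial σ K, (∀ A, W A ≠ 0 → ∃ b, w b A ≠ 0) ∧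
      ∀ b, strand b W = w b := by
  classical
  refine ⟨fun A => ∑ b ∈ T, monomial (b - indicatorExponent A) (w b A), fun A hA => ?_,
    fun b => ?_⟩
  · obtain ⟨b, -, hb⟩ := Finset.exists_ne_zero_of_sum_ne_zero hA
    exact ⟨b, fun h => hb (by rw [h, monomial_zero])⟩
  · ext A
    rw [strand]
    split_ifs with hA
    · rw [coeff_sum]
      simp only [coeff_monomial]
      rw [Finset.sum_eq_single b]
      · rw [if_pos rfl]
      · intro c _ hcb
        split_ifs with h
        · by_contra hne
          have hc := indicatorExponent_le_iff.mpr (hw c A hne)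
          exact hcb ((tsub_left_inj hc hA).mp h)
        · rfl
      · intro hb
        rw [hT b hb, if_pos rfl, Pi.zero_apply]
    · rw [indicatorExponent_le_iff] at hA
      exact (not_ne_iff.mp fun h => hA (hw b A h)).symm

end Strand

/-! ### Exactness over the polynomial ring -/

section PolynomialExactness

variable {m n : ℕ} {K : Type*} [Field K]

theorem strand_ne_zero {σ : Type*} [Fintype σ] [DecidableEq σ] {b : σ →₀ ℕ}
    {z : Finset σ → MvPolynomial σ K} {A : Finset σ} (h : strand b z A ≠ 0) :
    z A ≠ 0 ∧ A ⊆ b.support := by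
  rw [strand] at h
  split_ifs at h with hA
  · exact ⟨fun h0 => h (by rw [h0, coeff_zero]), indicatorExponent_le_iff.mp hA⟩
  · exact (h rfl).elim

open Classical in
theorem exists_boundary_X_eq_of_cycle {k : ℕ}
    {z : Finset (Fin m × Fin n) → MvPolynomial (Fin m × Fin n) K}
    (hz : ∀ A, z A ≠ 0 → IsCell A ∧ A.card = k)
    (hcyc : ∀ C, IsCell C → boundary toLex X z C = 0)
    (hsum : k = m → ∑ C with IsCell C, z C * monomial (indicatorExponent C) 1 = 0)
    (hmn : Nonempty (Fin m → Fin n)) :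
    ∃ w : Finset (Fin m × Fin n) → MvPolynomial (Fin m × Fin n) K,
      (∀ A, w A ≠ 0 → IsCell A ∧ A.card = k + 1) ∧
      ∀ C, IsCell C → boundary toLex X w C = z C := by
  -- The strands are solved one by one. The zero solution is imposed where the strand of `z`
  -- vanishes, so that only finitely many multidegrees contribute.
  have hex : ∀ b, ∃ w : Finset (Fin m × Fin n) → K,
      (∀ A, w A ≠ 0 → IsCell A ∧ A ⊆ b.support ∧ A.card = k + 1) ∧
      (∀ C, IsCell C → boundary toLex 1 w C = strand b z C) ∧ (strand b z = 0 → w = 0) := by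
    intro b
    by_cases h0 : strand b z = 0
    · refine ⟨0, by simp, fun C _ => ?_, fun _ => rfl⟩
      rw [h0]
      simp [boundary]
    · obtain ⟨w, hw, hwz⟩ := exists_boundary_eq_of_cycle (B := b.support) (k := k)
        (z := strand b z)
        (fun A hA => ⟨(hz A (strand_ne_zero hA).1).1, (strand_ne_zero hA).2,
          (hz A (strand_ne_zero hA).1).2⟩)
        (fun C hC => by
          rw [← strand_boundary, strand, hcyc C hC, coeff_zero, ite_self])
        (fun hk => by rw [← coeff_sum_mul_monomial, hsum hk, coeff_zero]) hmn
      exact ⟨w, hw, hwz, fun h => (h0 h).elim⟩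
  choose w hw hwz hw0 using hex
  obtain ⟨W, hW, hWw⟩ := exists_strand_eq
    (Finset.univ.biUnion fun A => (z A).support.image fun c => c + indicatorExponent A) w
    (fun b A hA => (hw b A hA).2.1) fun b hb => hw0 b <| by
      ext A
      rw [strand]
      split_ifs with hA
      · by_contra hne
        refine hb (Finset.mem_biUnion.mpr ⟨A, Finset.mem_univ _, Finset.mem_image.mpr
          ⟨b - indicatorExponent A, mem_support_iff.mpr hne, tsub_add_cancel_of_le hA⟩⟩)
      · rfl
  refine ⟨W, fun A hA => ?_, fun C hC => ?_⟩
  · obtain ⟨b, hb⟩ := hW A hA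
    exact ⟨(hw b A hb).1, (hw b A hb).2.2⟩
  · refine eq_of_strand_eq fun b => ?_
    rw [strand_boundary, hWw, hwz b C hC]

open Classical in
theorem sum_boundary_X_eq_zero
    {w : Finset (Fin m × Fin n) → MvPolynomial (Fin m × Fin n) K}
    (hw : ∀ A, w A ≠ 0 → IsCell A ∧ A.card = m + 1) :
    ∑ C with IsCell C, boundary toLex X w C * monomial (indicatorExponent C) 1 = 0 := by
  ext b
  rw [coeff_sum_mul_monomial, coeff_zero]
  simp only [strand_boundary]
  exact sum_boundary_eq_zero fun A hA => hw A (strand_ne_zero hA).1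

end PolynomialExactness

/-! ### The cellular resolution and the second homological shift ideal -/

section Resolution

variable {m n : ℕ} {K : Type*} [Field K]

/-- The cells that index the basis of the `i`th module of the resolution. -/
abbrev CellOf (m n i : ℕ) : Type :=
  {A : Finset (Fin m × Fin n) // IsCell A ∧ A.card = m + i}

open Classical in
/-- An element of the `i`th module of the resolution, as a function on all finite sets. -/
noncomputable def chainOf {i : ℕ} (z : CellOf m n i →₀ MvPolynomial (Fin m × Fin n) K)
    (A : Finset (Fin m × Fin n)) : MvPolynomial (Fin m × Fin n) K :=
  if h : IsCell A ∧ A.card = m + i then z ⟨A, h⟩ else 0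

theorem chainOf_ne_zero {i : ℕ} {z : CellOf m n i →₀ MvPolynomial (Fin m × Fin n) K}
    {A : Finset (Fin m × Fin n)} (h : chainOf z A ≠ 0) : IsCell A ∧ A.card = m + i := by
  by_contra hA
  exact h (dif_neg hA)

theorem chainOf_coe {i : ℕ} (z : CellOf m n i →₀ MvPolynomial (Fin m × Fin n) K)
    (A : CellOf m n i) : chainOf z A.1 = z A := dif_pos A.2

theorem chainOf_add {i : ℕ} (z w : CellOf m n i →₀ MvPolynomial (Fin m × Fin n) K) :
    chainOf (z + w) = chainOf z + chainOf w := by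
  ext1 A
  simp only [chainOf, Pi.add_apply]
  split_ifs <;> simp

theorem chainOf_smul {i : ℕ} (a : MvPolynomial (Fin m × Fin n) K)
    (z : CellOf m n i →₀ MvPolynomial (Fin m × Fin n) K) :
    chainOf (a • z) = a • chainOf z := by
  ext1 A
  simp only [chainOf, Pi.smul_apply]
  split_ifs <;> simp

theorem exists_chainOf_eq {i : ℕ} {w : Finset (Fin m × Fin n) → MvPolynomial (Fin m × Fin n) K}
    (hw : ∀ A, w A ≠ 0 → IsCell A ∧ A.card = m + i) :
    ∃ z : CellOf m n i →₀ MvPolynomial (Fin m × Fin n) K, chainOf z = w := by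
  refine ⟨Finsupp.equivFunOnFinite.symm fun A => w A.1, ?_⟩
  ext1 A
  rw [chainOf]
  split_ifs with h
  · rfl
  · exact (not_ne_iff.mp (mt (hw A) h)).symm

/-- The differential of the cellular resolution. -/
noncomputable def cellDifferential (K : Type*) [Field K] (m n i : ℕ) :
    (CellOf m n (i + 1) →₀ MvPolynomial (Fin m × Fin n) K) →ₗ[MvPolynomial (Fin m × Fin n) K]
      (CellOf m n i →₀ MvPolynomial (Fin m × Fin n) K) where
  toFun z := Finsupp.equivFunOnFinite.symm fun C => boundary toLex X (chainOf z) C.1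
  map_add' z w := by
    ext1 C
    simp [chainOf_add, boundary_add]
  map_smul' a z := by
    ext1 C
    simp [chainOf_smul, boundary_smul]

theorem cellDifferential_apply {i : ℕ}
    (z : CellOf m n (i + 1) →₀ MvPolynomial (Fin m × Fin n) K) (C : CellOf m n i) :
    cellDifferential K m n i z C = boundary toLex X (chainOf z) C.1 := rfl

theorem chainOf_cellDifferential {i : ℕ}
    (z : CellOf m n (i + 1) →₀ MvPolynomial (Fin m × Fin n) K) {C : Finset (Fin m × Fin n)}
    (hC : IsCell C) :
    chainOf (cellDifferential K m n i z) C = boundary toLex X (chainOf z) C := by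
  rw [chainOf]
  split_ifs with h
  · rfl
  · by_contra hne
    obtain ⟨x, hx, hz⟩ := boundary_support (Ne.symm hne)
    have := (chainOf_ne_zero hz).2
    rw [Finset.card_insert_of_notMem hx] at this
    exact h ⟨hC, by omega⟩

/-- The augmentation of the cellular resolution. -/
noncomputable def cellAugmentation (K : Type*) [Field K] (m n : ℕ) :
    (CellOf m n 0 →₀ MvPolynomial (Fin m × Fin n) K) →ₗ[MvPolynomial (Fin m × Fin n) K]
      MvPolynomial (Fin m × Fin n) K :=
  Finsupp.linearCombination _ fun A => monomial (indicatorExponent A.1) 1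

open Classical in
theorem cellAugmentation_apply (z : CellOf m n 0 →₀ MvPolynomial (Fin m × Fin n) K) :
    cellAugmentation K m n z =
      ∑ C with IsCell C, chainOf z C * monomial (indicatorExponent C) 1 := by
  rw [LinearMap.apply_eq_sum_single,
    ← Finset.sum_filter_of_ne (p := fun C : Finset (Fin m × Fin n) => C.card = m + 0),
    Finset.filter_filter]
  · rw [Finset.sum_subtype (p := fun C => IsCell C ∧ C.card = m + 0) _ (by simp)]
    refine Finset.sum_congr rfl fun C _ => ?_
    rw [chainOf_coe, cellAugmentation, Finsupp.linearCombination_single, one_smul, smul_eq_mul]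
  · intro C _ h
    exact (chainOf_ne_zero (left_ne_zero_of_mul h)).2

theorem range_cellAugmentation :
    LinearMap.range (cellAugmentation K m n) = coLetterplaceIdeal K (Fin m) n := by
  rw [cellAugmentation, Finsupp.range_linearCombination, coLetterplaceIdeal, Ideal.span]
  congr 1
  have himg : ∀ f : Fin m → Fin n,
      (monomial (indicatorExponent (Finset.univ.image fun p => (p, f p))) 1 :
        MvPolynomial (Fin m × Fin n) K) = ∏ p, X (p, f p) := fun f => by
    rw [monomial_indicatorExponent, Finset.prod_image fun p _ q _ h => (Prod.mk.inj h).1]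
  have hcard : ∀ f : Fin m → Fin n, (Finset.univ.image fun p => (p, f p)).card = m := fun f => by
    rw [Finset.card_image_of_injective _ fun p q h => (Prod.mk.inj h).1, Finset.card_univ,
      Fintype.card_fin]
  ext u
  constructor
  · rintro ⟨⟨A, hA, hAm⟩, rfl⟩
    choose f hf using hA.2
    have hAf : Finset.univ.image (fun p => (p, f p)) = A := by
      refine Finset.eq_of_subset_of_card_le ?_ ?_
      · intro x hx
        obtain ⟨p, -, rfl⟩ := Finset.mem_image.mp hx
        exact hf p
      · rw [hcard, hAm, add_zero]
    refine ⟨⟨f, fun p q hpq => ?_⟩, ?_⟩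
    · rcases hA.1 _ (hf p) _ (hf q) with h | h
      · exact h.2
      · rw [le_antisymm hpq h.1]
    · simp only [← hAf]
      exact (himg f).symm
  · rintro ⟨f, rfl⟩
    refine ⟨⟨Finset.univ.image fun p => (p, f p), ⟨?_, fun p => ⟨f p, by simp⟩⟩, hcard f⟩, himg f⟩
    intro x hx y hy
    obtain ⟨p, -, rfl⟩ := Finset.mem_image.mp hx
    obtain ⟨q, -, rfl⟩ := Finset.mem_image.mp hy
    rcases le_total p q with h | h
    · exact Or.inl ⟨h, f.monotone h⟩
    · exact Or.inr ⟨h, f.monotone h⟩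

theorem weight_multiWeight {σ : Type*} (d : σ →₀ ℕ) :
    Finsupp.weight (multiWeight σ) d = fun x => (d x : ℤ) := by
  classical
  ext x
  rw [Finsupp.weight_apply, Finsupp.sum, Finset.sum_apply]
  simp only [multiWeight, Pi.smul_apply]
  rw [Finset.sum_eq_single x]
  · simp
  · intro y _ hyx
    rw [Pi.single_eq_of_ne hyx.symm, smul_zero]
  · intro hx
    simp [Finsupp.notMem_support_iff.mp hx]

theorem chainOf_single {i : ℕ} (A : CellOf m n i) (C : Finset (Fin m × Fin n)) :
    chainOf (Finsupp.single A (1 : MvPolynomial (Fin m × Fin n) K)) C =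
      if C = A.1 then 1 else 0 := by
  split_ifs with h
  · rw [h, chainOf_coe, Finsupp.single_eq_same]
  · rw [chainOf]
    split_ifs with h'
    · exact Finsupp.single_eq_of_ne fun heq => h (congrArg Subtype.val heq)
    · rfl

/-- The multigraded cellular resolution of the co-letterplace ideal of a chain. -/
noncomputable def cellResolution (K : Type*) [Field K] {m n : ℕ} (hmn : Nonempty (Fin m → Fin n)) :
    GradedFreeResolution (multiWeight (Fin m × Fin n)) (coLetterplaceIdeal K (Fin m) n) where
  ι := CellOf m n
  finite _ := inferInstance
  shift _ A x := (indicatorExponent A.1 x : ℤ)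
  d := cellDifferential K m n
  ε := cellAugmentation K m n
  homogeneous_d i A C := by
    rw [cellDifferential_apply]
    refine IsWeightedHomogeneous.sum _ _ _ fun x hx => ?_
    rw [Finset.mem_compl] at hx
    rw [chainOf_single]
    split_ifs with h
    · rw [mul_one, ← mem_weightedHomogeneousSubmodule]
      refine zsmul_mem ?_ _
      rw [mem_weightedHomogeneousSubmodule]
      intro e he
      refine (isWeightedHomogeneous_X K (multiWeight (Fin m × Fin n)) x he).trans ?_
      ext y
      simp [← h, indicatorExponent_insert hx, multiWeight, Finsupp.single_apply, Pi.single_apply, eq_comm]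
    · rw [mul_zero, smul_zero]
      exact isWeightedHomogeneous_zero _ _ _
  homogeneous_ε A := by
    rw [cellAugmentation, Finsupp.linearCombination_single, one_smul]
    exact isWeightedHomogeneous_monomial _ _ _ (weight_multiWeight _)
  range_ε := range_cellAugmentation
  exact_ε z := by
    constructor
    · intro h
      obtain ⟨w, hw, hwz⟩ := exists_boundary_X_eq_of_cycle (k := m + 0) (z := chainOf z)
        (fun A => chainOf_ne_zero)
        -- In lowest degree the cycle condition is automatic: a nonzero boundary at `C` would leave
        -- `C` with only `m - 1` points for `m` rows.
        (fun C hC => by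
          by_contra hne
          obtain ⟨x, hx, hz⟩ := boundary_support hne
          have h1 := (chainOf_ne_zero hz).2
          rw [Finset.card_insert_of_notMem hx] at h1
          have h2 := card_le_of_forall_exists_mem hC.2
          omega)
        (fun _ => by rw [← cellAugmentation_apply, h]) hmn
      obtain ⟨y, rfl⟩ := exists_chainOf_eq (i := 1) hw
      refine ⟨y, ?_⟩
      ext1 C
      rw [cellDifferential_apply, hwz C.1 C.2.1, chainOf_coe]
    · rintro ⟨y, rfl⟩
      classical
      rw [cellAugmentation_apply, ← sum_boundary_X_eq_zero fun A => chainOf_ne_zero (z := y)]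
      refine Finset.sum_congr rfl fun C hC => ?_
      rw [chainOf_cellDifferential _ (Finset.mem_filter.mp hC).2]
  exact_d i z := by
    constructor
    · intro h
      obtain ⟨w, hw, hwz⟩ := exists_boundary_X_eq_of_cycle (k := m + (i + 1)) (z := chainOf z)
        (fun A => chainOf_ne_zero)
        (fun C hC => by
          rw [← chainOf_cellDifferential z hC, h]
          simp [chainOf])
        (fun h => by omega) hmn
      obtain ⟨y, rfl⟩ := exists_chainOf_eq (i := i + 2) hw
      refine ⟨y, ?_⟩
      ext1 C
      rw [cellDifferential_apply, hwz C.1 C.2.1, chainOf_coe]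
    · rintro ⟨y, rfl⟩
      ext1 C
      rw [cellDifferential_apply, Finsupp.zero_apply, ← boundary_boundary toLex.injective X
        (chainOf y) C.1]
      refine Finset.sum_congr rfl fun x _ => ?_
      by_cases hx : IsCell (insert x C.1)
      · rw [chainOf_cellDifferential y hx]
      · rw [boundary_eq_zero_of_not_isCell (fun A hA => (chainOf_ne_zero hA).1) C.2.1
          (Finset.subset_insert x C.1) hx, chainOf, dif_neg fun h => hx h.1]

theorem cellResolution_isMinimal (hmn : Nonempty (Fin m → Fin n)) :
    (cellResolution K hmn).IsMinimal := by
  intro i A C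
  change constantCoeff (boundary toLex X _ _) = 0
  simp [boundary]

/-- Any minimal resolution has its second shifts among those of `cellResolution`, which is itself
minimal and so realizes all of them. -/
theorem isMultigradedShift_two_iff (hmn : Nonempty (Fin m → Fin n))
    {a : Fin m × Fin n →₀ ℕ} :
    IsMultigradedShift (coLetterplaceIdeal K (Fin m) n) 2 (fun x => (a x : ℤ)) ↔
      ∃ A, IsCell A ∧ A.card = m + 2 ∧ indicatorExponent A = a := by
  constructor
  · rintro ⟨F, hF, j, hj⟩
    obtain ⟨A, hA⟩ := hF.exists_shift_two_eq (cellResolution K hmn) j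
    refine ⟨A.1, A.2.1, A.2.2, ?_⟩
    ext x
    exact Nat.cast_injective (R := ℤ) (congrFun (hA.trans hj) x)
  · rintro ⟨A, hA, hcard, rfl⟩
    exact ⟨cellResolution K hmn, cellResolution_isMinimal hmn, ⟨A, hA, hcard⟩, rfl⟩

theorem homologicalShiftIdeal_two_eq (hmn : Nonempty (Fin m → Fin n)) :
    homologicalShiftIdeal 2 (coLetterplaceIdeal K (Fin m) n) =
      Ideal.span ((fun a => monomial a (1 : K)) ''
        {a | ∃ A : Finset (Fin m × Fin n), IsCell A ∧ A.card = m + 2 ∧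
          indicatorExponent A = a}) := by
  unfold homologicalShiftIdeal
  congr 1
  ext u
  simp only [isMultigradedShift_two_iff hmn, Set.mem_ofPred_eq, Set.mem_image, eq_comm]

end Resolution

/-! ### The isolated pair of cells -/

section IsolatedPair

variable {m n : ℕ}

/-- The cell whose rows are `{1, 2, 3}, {3}, …, {3}`. -/
def lowerCell (m n : ℕ) : Finset (Fin m × Fin n) :=
  Finset.univ.filter fun x => x.2.val = 2 ∨ (x.1.val = 0 ∧ x.2.val ≤ 2)

/-- The cell whose rows are `{1}, …, {1}, {1, 2, 3}`. -/
def upperCell (m n : ℕ) : Finset (Fin m × Fin n) :=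
  Finset.univ.filter fun x => x.2.val = 0 ∨ (x.1.val + 1 = m ∧ x.2.val ≤ 2)

theorem isCell_lowerCell (hn : 3 ≤ n) : IsCell (lowerCell m n) := by
  refine ⟨?_, fun p => ⟨⟨2, hn⟩, by simp [lowerCell]⟩⟩
  rintro ⟨⟨p, hp⟩, ⟨a, ha⟩⟩ hx ⟨⟨q, hq⟩, ⟨b, hb⟩⟩ hy
  simp only [lowerCell, Finset.mem_filter, Finset.mem_univ, true_and] at hx hy
  simp only [Prod.mk_le_mk, Fin.mk_le_mk]
  omega

theorem isCell_upperCell (hn : 3 ≤ n) : IsCell (upperCell m n) := by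
  refine ⟨?_, fun p => ⟨⟨0, by omega⟩, by simp [upperCell]⟩⟩
  rintro ⟨⟨p, hp⟩, ⟨a, ha⟩⟩ hx ⟨⟨q, hq⟩, ⟨b, hb⟩⟩ hy
  simp only [upperCell, Finset.mem_filter, Finset.mem_univ, true_and] at hx hy
  simp only [Prod.mk_le_mk, Fin.mk_le_mk]
  omega

theorem card_rowExtended (p₀ : Fin m) {a b c : Fin n} (hab : a ≠ b) (hac : a ≠ c) (hbc : b ≠ c) :
    (insert (p₀, b) (insert (p₀, c) (Finset.univ.image fun p : Fin m => (p, a)))).card =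
      m + 2 := by
  rw [Finset.card_insert_of_notMem, Finset.card_insert_of_notMem,
    Finset.card_image_of_injective _ fun p q h => (Prod.mk.inj h).1, Finset.card_univ,
    Fintype.card_fin]
  · simp [hac]
  · simp [hab, hbc]

theorem card_lowerCell (hm : 3 ≤ m) (hn : 3 ≤ n) : (lowerCell m n).card = m + 2 := by
  rw [← card_rowExtended (⟨0, by omega⟩ : Fin m) (a := (⟨2, hn⟩ : Fin n)) (b := ⟨0, by omega⟩)
    (c := ⟨1, by omega⟩) (by simp) (by simp) (by simp)]
  congr 1
  ext ⟨⟨p, hp⟩, ⟨a, ha⟩⟩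
  simp only [lowerCell, Finset.mem_filter, Finset.mem_univ, true_and, Finset.mem_insert,
    Finset.mem_image, Prod.mk.injEq, Fin.mk.injEq, exists_eq_left]
  omega

theorem card_upperCell (hm : 3 ≤ m) (hn : 3 ≤ n) : (upperCell m n).card = m + 2 := by
  rw [← card_rowExtended (⟨m - 1, by omega⟩ : Fin m) (a := (⟨0, by omega⟩ : Fin n))
    (b := ⟨1, by omega⟩) (c := ⟨2, hn⟩) (by simp) (by simp) (by simp)]
  congr 1
  ext ⟨⟨p, hp⟩, ⟨a, ha⟩⟩
  simp only [upperCell, Finset.mem_filter, Finset.mem_univ, true_and, Finset.mem_insert,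
    Finset.mem_image, Prod.mk.injEq, Fin.mk.injEq, exists_eq_left]
  omega

/-- A cell all of whose columns are the first or the third one has at most `m + 1` elements. -/
theorem IsCell.card_le_of_columns {A : Finset (Fin m × Fin n)} (hA : IsCell A)
    (h : ∀ x ∈ A, x.2.val = 0 ∨ x.2.val = 2) : A.card ≤ m + 1 := by
  rw [← Finset.card_range (m + 1)]
  -- Halving turns the columns `0`, `2` into `0`, `1`; the sum with the row index strictly increases
  -- along a chain and takes values in `0, …, m`.
  refine Finset.card_le_card_of_injOn (fun x => x.1.val + x.2.val / 2) ?_ ?_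
  · intro x hx
    have := h x hx
    have := x.1.2
    simp only [Finset.coe_range, Set.mem_Iio]
    omega
  · rintro ⟨⟨p, hp⟩, ⟨a, ha⟩⟩ hx ⟨⟨q, hq⟩, ⟨b, hb⟩⟩ hy hxy
    have h1 := hA.1 _ hx _ hy
    have h2 := h _ hx
    have h3 := h _ hy
    simp only [Prod.mk_le_mk, Fin.mk_le_mk, Prod.mk.injEq, Fin.mk.injEq] at *
    omega

/-- By counting, `A` has a point in column `1`, which lies in the first or the last row.
Comparability with a point of the middle row `1` forces that point into column `2` or `0`
respectively; these two points then confine `A` to one of the two cells, and the cardinalities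
agree. -/
theorem eq_lowerCell_or_eq_upperCell (hm : 3 ≤ m) (hn : 3 ≤ n) {A : Finset (Fin m × Fin n)}
    (hA : IsCell A) (hcard : A.card = m + 2) (hsub : A ⊆ lowerCell m n ∪ upperCell m n) :
    A = lowerCell m n ∨ A = upperCell m n := by
  have hmem : ∀ x ∈ A, x.2.val = 0 ∨ x.2.val = 2 ∨
      (x.2.val = 1 ∧ (x.1.val = 0 ∨ x.1.val + 1 = m)) := by
    intro x hx
    have h := hsub hx
    simp only [lowerCell, upperCell, Finset.mem_union, Finset.mem_filter, Finset.mem_univ,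
      true_and] at h
    omega
  have hchain : ∀ x ∈ A, ∀ y ∈ A, (x.1.val ≤ y.1.val ∧ x.2.val ≤ y.2.val) ∨
      (y.1.val ≤ x.1.val ∧ y.2.val ≤ x.2.val) := hA.1
  -- Row `1` is neither first nor last because `m ≥ 3`, so only columns `0` and `2` are available
  -- there.
  obtain ⟨c, hc⟩ := hA.2 ⟨1, by omega⟩
  have hc' := hmem _ hc
  simp only at hc'
  by_cases h1 : ∃ x ∈ A, x.2.val = 1
  · obtain ⟨x, hx, hx1⟩ := h1
    have hxm := hmem x hx
    have hxc := hchain x hx _ hc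
    simp only at hxc
    rcases Nat.eq_zero_or_pos x.1.val with h0 | h0
    · left
      refine Finset.eq_of_subset_of_card_le (fun y hy => ?_)
        (by rw [card_lowerCell hm hn, hcard])
      have h2 := hmem y hy
      have h3 := hchain x hx y hy
      have h4 := hchain y hy _ hc
      simp only at h4
      simp only [lowerCell, Finset.mem_filter, Finset.mem_univ, true_and]
      omega
    · right
      refine Finset.eq_of_subset_of_card_le (fun y hy => ?_)
        (by rw [card_upperCell hm hn, hcard])
      have h2 := hmem y hy
      have h3 := hchain x hx y hy
      have h4 := hchain y hy _ hc
      simp only at h4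
      simp only [upperCell, Finset.mem_filter, Finset.mem_univ, true_and]
      have := y.1.2
      omega
  · push Not at h1
    have := hA.card_le_of_columns fun x hx => by
      have := hmem x hx
      have := h1 x hx
      omega
    omega

theorem indicatorExponent_sup {σ : Type*} [Fintype σ] [DecidableEq σ] (A B : Finset σ) :
    indicatorExponent A ⊔ indicatorExponent B = indicatorExponent (A ∪ B) := by
  ext x
  simp only [Finsupp.sup_apply, indicatorExponent_apply, Finset.mem_union]
  by_cases hA : x ∈ A <;> by_cases hB : x ∈ B <;> simp [hA, hB]

theorem indicatorExponent_le_indicatorExponent_iff {σ : Type*} [Fintype σ] [DecidableEq σ]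
    {A B : Finset σ} : indicatorExponent A ≤ indicatorExponent B ↔ A ⊆ B := by
  rw [indicatorExponent_le_iff]
  have : (indicatorExponent B).support = B := by
    ext x
    simp [indicatorExponent_apply]
  rw [this]

/-- In the last row the upper cell has two points, in columns `0` and `1`, that the lower cell
lacks; one variable can supply only one of them. -/
theorem not_indicatorExponent_upperCell_le (hm : 3 ≤ m) (hn : 3 ≤ n) (x : Fin m × Fin n) :
    ¬ indicatorExponent (upperCell m n) ≤
      indicatorExponent (lowerCell m n) + Finsupp.single x 1 := by
  intro h
  have key : ∀ a : Fin n, a.val ≤ 1 → x = (⟨m - 1, by omega⟩, a) := by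
    intro a ha
    have h1 := h (⟨m - 1, by omega⟩, a)
    rw [Finsupp.add_apply, indicatorExponent_apply, indicatorExponent_apply, if_pos, if_neg,
      Finsupp.single_apply] at h1
    · by_contra hne
      simp [hne] at h1
    · simp only [lowerCell, Finset.mem_filter, Finset.mem_univ, true_and]
      omega
    · simp only [upperCell, Finset.mem_filter, Finset.mem_univ, true_and]
      omega
  have h0 := key ⟨0, by omega⟩ (by simp)
  have h1 := key ⟨1, by omega⟩ le_rfl
  rw [h0] at h1
  simp at h1

end IsolatedPair

theorem proposition3 {K : Type*} [Field K] (m n : ℕ) (hm : 3 ≤ m) (hn : 3 ≤ n) :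
    ¬ HasLinearResolution (homologicalShiftIdeal 2 (coLetterplaceIdeal K (Fin m) n)) := by
  rw [homologicalShiftIdeal_two_eq ⟨fun _ => ⟨0, by omega⟩⟩]
  refine not_hasLinearResolution_of_isolated_pair (N := m + 2)
    (u := indicatorExponent (lowerCell m n)) (v := indicatorExponent (upperCell m n)) ?_
    ⟨_, isCell_lowerCell hn, card_lowerCell hm hn, rfl⟩
    ⟨_, isCell_upperCell hn, card_upperCell hm hn, rfl⟩ ?_ ?_
    (not_indicatorExponent_upperCell_le hm hn)
  · rintro _ ⟨A, -, hA, rfl⟩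
    rw [degree_indicatorExponent, hA]
  · intro h
    -- Equality of the exponents would give divisibility after multiplying by any variable; the
    -- chosen one is arbitrary.
    exact not_indicatorExponent_upperCell_le hm hn (⟨0, by omega⟩, ⟨0, by omega⟩)
      (h.symm.le.trans le_self_add)
  · rintro _ ⟨A, hA, hcard, rfl⟩ hle
    rw [indicatorExponent_sup, indicatorExponent_le_indicatorExponent_iff] at hle
    rcases eq_lowerCell_or_eq_upperCell hm hn hA hcard hle with rfl | rfl
    · exact Or.inl rfl
    · exact Or.inr rfl
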